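/- Let $p$ be a prime, $\omega=e^{2\pi i/p}$, and let $\mathrm{Irr}(G)$ be the set of irreducible complex characters of a finite group $G$. Let $C_p\le S_p$ be generated by the $p$-cycle $\gamma=(1,\dots,p)$, and let $\phi_\varepsilon$ ($0\le\varepsilon\le p-1$) be its character with $\phi_\varepsilon(\gamma)=\omega^\varepsilon$. **Groups.** $P_{1}$ is trivial and, for $k\ge1$, $P_{p^k}=P_{p^{k-1}}\wr C_p=(P_{p^{k-1}})^{\times p}\rtimes C_p$ is the Sylow $p$-subgroup of $S_{p^k}$ in its canonical (blockwise) permutation representation; in particular $P_p=C_p$. If $\varphi\in\mathrm{Irr}(P_{p^{k-1}})$ is afforded by $V$, then $\mathcal X(\varphi;\varepsilon)$ is the character of $P_{p^k}$ on $V^{\otimes p}$, where $(g_1,\dots,g_p;h)$ maps $v_1\otimes\cdots\otimes v_p$ to $g_1v_{h^{-1}(1)}\otimes\cdots\otimes g_pv_{h^{-1}(p)}$, multiplied by the inflation of $\phi_\varepsilon$. For $\theta_1,\dots,\theta_p\in\mathrm{Irr}(P_{p^{k-1}})$, $(\theta_1\times\cdots\times\theta_p)\!\uparrow$ is the character of $P_{p^k}$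 induced from the character $\theta_1\times\cdots\times\theta_p$ of the base group $(P_{p^{k-1}})^{\times p}$. **Tree functions.** Let $\mathrm{sk}_{p^k}$ be the set of sequences of length at most $k-1$ with entries in $\{1,\dots,p\}$. A labelling function is a map $t:\mathrm{sk}_{p^k}\to\{0,\dots,p\}$. Write $t\sim t'$ if there are $\gamma_{q}\in C_p$ ($q\in\mathrm{sk}_{p^{k-1}}$) such that $t(s_1\cdots s_\ell)=t'(\gamma_{\emptyset}(s_1)\,\gamma_{s_1}(s_2)\cdots\gamma_{s_1\cdots s_{\ell-1}}(s_\ell))$ for all $s_1\cdots s_\ell\in\mathrm{sk}_{p^k}$ (so $t(\emptyset)=t'(\emptyset)$). This is an equivalence relation; its classes are the $p^k$-tree functions. The subfunction of $t$ rooted at $s$ is $q\mapsto t(sq)$. $T^\varepsilon$ denotes the $p$-tree function with value $\varepsilon$ at $\emptyset$, and $(T_1|\cdots|T_p;\varepsilon)$ the $p^k$-tree function ($k\ge 2$) with value $\varepsilon$ at $\emptyset$ and with subfunctions at $1,\dots,p$ of classes $T_1,\dots,T_p$. A $p$-tree function is admissible if its label at $\emptyset$ is not $p$. For $k>1$, the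 $p^k$-tree function of $t$ is admissible if $t(s)\ne p$ for every $s$ of length $k-1$ and, for every $s$ of length less than $k-1$, the classes of the subfunctions of $t$ rooted at $s1,\dots,sp$ are admissible, and are all equal if $t(s)\le p-1$, not all equal if $t(s)=p$. (This does not depend on the representative $t$.) Let $\mathcal F_{p^k}$ be the set of admissible $p^k$-tree functions; $\mathcal F_{p^0}$ is the one-element set consisting of the class of the empty function. **Statement.** (a) There is exactly one family of maps $\Phi_{p^k}:\mathrm{Irr}(P_{p^k})\to\mathcal F_{p^k}$, $k\ge1$, such that $\Phi_p(\phi_\varepsilon)=T^\varepsilon$ for $0\le\varepsilon\le p-1$ and, for $k\ge2$ and $\theta\in\mathrm{Irr}(P_{p^k})$, $$\Phi_{p^k}(\theta)=\begin{cases}(\Phi_{p^{k-1}}(\varphi)|\cdots|\Phi_{p^{k-1}}(\varphi);\varepsilon)&\text{whenever }\theta=\mathcal X(\varphi;\varepsilon),\ \varphi\in\mathrm{Irr}(P_{p^{k-1}}),\ 0\le\varepsilon\le p-1,\\(\Phi_{p^{k-1}}(\theta_1)|\cdots|\Phi_{p^{k-1}}(\theta_p);p)&\text{whenever }\theta=(\theta_1\times\cdots\times\theta_p)\!\uparrow,\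 \theta_i\in\mathrm{Irr}(P_{p^{k-1}})\text{ not all equal.}\end{cases}$$ That is, $\Phi_{p^k}$ is well defined. (b) For every $k\ge1$, $\Phi_{p^k}$ is a bijection from $\mathrm{Irr}(P_{p^k})$ to $\mathcal F_{p^k}$. (c) The inverse maps $\Psi_{p^k}=\Phi_{p^k}^{-1}:\mathcal F_{p^k}\to\mathrm{Irr}(P_{p^k})$, $k\ge 1$, form the unique family given recursively by $\Psi_p(T^\varepsilon)=\phi_\varepsilon$ for $0\le\varepsilon\le p-1$ and, for $k\ge2$ and $T=(T_1|\cdots|T_p;\varepsilon)\in\mathcal F_{p^k}$ with $T_1,\dots,T_p\in\mathcal F_{p^{k-1}}$, $$\Psi_{p^k}(T)=\begin{cases}\mathcal X(\Psi_{p^{k-1}}(T_1);\varepsilon)&\text{if }\varepsilon\le p-1,\\(\Psi_{p^{k-1}}(T_1)\times\cdots\times\Psi_{p^{k-1}}(T_p))\!\uparrow&\text{if }\varepsilon=p.\end{cases}$$ (d) For $k=0$ let $\Phi_{p^0},\Psi_{p^0}$ be the maps between the one-element sets $\mathrm{Irr}(P_1)$ and $\mathcal F_{p^0}$. Let $n\ge0$,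 let $o(1)\ge\cdots\ge o(q)\ge0$ be the exponents of the $p$-adic expansion of $n$, each repeated as often as the corresponding digit says, so that $n=\sum_jp^{o(j)}$, and let $P_n=P_{p^{o(1)}}\times\cdots\times P_{p^{o(q)}}\le S_n$ act on consecutive blocks of lengths $p^{o(j)}$. Then every $\theta\in\mathrm{Irr}(P_n)$ is $\theta_1\times\cdots\times\theta_q$ for unique $\theta_j\in\mathrm{Irr}(P_{p^{o(j)}})$; the map $\Phi_n(\theta)=(\Phi_{p^{o(1)}}(\theta_1),\dots,\Phi_{p^{o(q)}}(\theta_q))$ is a bijection from $\mathrm{Irr}(P_n)$ to $\mathcal F_n=\prod_j\mathcal F_{p^{o(j)}}$; and its inverse is $\Psi_n(T_1,\dots,T_q)=\Psi_{p^{o(1)}}(T_1)\times\cdots\times\Psi_{p^{o(q)}}(T_q)$. -/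

import Mathlib

open Equiv

noncomputable section

namespace SylowTree

/-! ### Irreducible characters, induction, external products -/

/-- The irreducible complex characters of `G`, as functions `G → ℂ`. Every finite-dimensional
complex representation is isomorphic to one on some `ℂⁿ`. -/
def Irr (G : Type) [Group G] : Type :=
  {χ : G → ℂ // ∃ (n : ℕ) (ρ : Representation ℂ G (Fin n → ℂ)),
    ρ.IsIrreducible ∧ ρ.character = χ}

/-- The dimension of a chosen module affording `φ`. -/
def Irr.dim {G : Type} [Group G] (φ : Irr G) : ℕ := φ.2.choose

/-- A chosen irreducible representation affording `φ` (unique up to isomorphism). -/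
def Irr.rep {G : Type} [Group G] (φ : Irr G) : Representation ℂ G (Fin φ.dim → ℂ) :=
  φ.2.choose_spec.choose

theorem Irr.rep_character {G : Type} [Group G] (φ : Irr G) : φ.rep.character = φ.1 :=
  φ.2.choose_spec.choose_spec.2

/-- Induction of class functions along an embedding `ι : N → G` of finite groups:
`(χ↑G)(g) = |N|⁻¹ ∑_{x ∈ G} χ°(x⁻¹ g x)`, where `χ°` is `χ` on `N` and `0` off `N`. -/
def induce {N G : Type} [Group N] [Group G] (ι : N →* G) (χ : N → ℂ) (g : G) : ℂ :=
  (Nat.card N : ℂ)⁻¹ * ∑ᶠ x : G, Function.extend ι χ 0 (x⁻¹ * g * x)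

/-- The external product `χ_1 × ⋯ × χ_m` on a direct product of groups. -/
def outer {m : ℕ} {G : Fin m → Type} (χ : ∀ i, G i → ℂ) (f : ∀ i, G i) : ℂ :=
  ∏ i, χ i (f i)

/-! ### Wreath products with the cyclic group of order `p` -/

/-- `C_p`, generated by the `p`-cycle `i ↦ i + 1` of the `p` indices. -/
abbrev Cyc (p : ℕ) : Subgroup (Perm (Fin p)) := Subgroup.zpowers (finRotate p)

/-- The linear character `φ_ε` of `C_p`, with `φ_ε(γ) = ω ^ ε` for the generator `γ`, where
`ω = exp(2πi/p)`. (If `g = γ ^ m` then `g 0 = m` modulo `p`.) -/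
def cycChar {p : ℕ} [NeZero p] (ε : Fin p) (g : Cyc p) : ℂ :=
  Complex.exp (2 * Real.pi * Complex.I / p) ^ ((ε : ℕ) * ((g : Perm (Fin p)) 0 : ℕ))

/-- The wreath product `G ≀ C_p = G^p ⋊ C_p`, where `h` acts on `G^p` by
`(h • f) i = f (h⁻¹ i)`. -/
abbrev Wr (p : ℕ) (G : Type) [Group G] : Type :=
  (Fin p → G) ⋊[(mulAutArrow : Cyc p →* MulAut (Fin p → G))] (Cyc p)

theorem mulAutArrow_cyc {p : ℕ} {G : Type} [Group G] (h : Cyc p) (f : Fin p → G) (i : Fin p) :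
    (mulAutArrow h : MulAut (Fin p → G)) f i = f ((h : Perm (Fin p))⁻¹ i) := rfl

open scoped TensorProduct in
/-- The module `V^{⊗p}` for `G ≀ C_p`: the element `(g_1, …, g_p; h)` sends
`v_1 ⊗ ⋯ ⊗ v_p` to `g_1 v_{h⁻¹(1)} ⊗ ⋯ ⊗ g_p v_{h⁻¹(p)}`. -/
def tensorExt {p : ℕ} {G V : Type} [Group G] [AddCommGroup V] [Module ℂ V]
    (ρ : Representation ℂ G V) : Representation ℂ (Wr p G) (⨂[ℂ] _ : Fin p, V) where
  toFun w := PiTensorProduct.map (fun i => ρ (w.left i)) ∘ₗ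
    (PiTensorProduct.reindex ℂ (fun _ : Fin p => V) (w.right : Perm (Fin p))).toLinearMap
  map_one' := by
    ext v
    simp [PiTensorProduct.reindex_tprod]
    rfl
  map_mul' a b := by
    ext v
    simp [PiTensorProduct.reindex_tprod]
    rfl

/-- The character `X(φ; ε)` of `G ≀ C_p`: the character of `V^{⊗p}`, where `V` affords `φ`,
multiplied by the inflation of `φ_ε`. -/
def wrX {p : ℕ} [NeZero p] {G : Type} [Group G] (φ : Irr G) (ε : Fin p) (w : Wr p G) : ℂ :=
  (tensorExt (p := p) φ.rep).character w * cycChar ε w.right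

/-- The imprimitive permutation action of `G ≀ C_p` on `p` copies of the set on which `G` acts. -/
def wrPerm {p : ℕ} {X : Type} (G : Subgroup (Perm X)) : Wr p G →* Perm (Fin p × X) where
  toFun w :=
    { toFun := fun y => ((w.right : Perm (Fin p)) y.1,
        (w.left ((w.right : Perm (Fin p)) y.1) : Perm X) y.2)
      invFun := fun y => ((w.right : Perm (Fin p))⁻¹ y.1, (w.left y.1 : Perm X)⁻¹ y.2)
      left_inv := fun y => by simp
      right_inv := fun y => by simp }
  map_one' := by
    ext y <;> simp
  map_mul' a b := by
    refine Equiv.ext fun y => Prod.ext rfl ?_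
    change (a.left _ : Perm X) ((b.left ((a.right : Perm (Fin p))⁻¹
      ((a.right : Perm (Fin p)) ((b.right : Perm (Fin p)) y.1))) : Perm X) y.2) = _
    have h : (a.right : Perm (Fin p))⁻¹
      ((a.right : Perm (Fin p)) ((b.right : Perm (Fin p)) y.1)) = (b.right : Perm (Fin p)) y.1 := by
      simp
    rw [h]
    rfl

theorem wrPerm_injective {p : ℕ} {X : Type} [Nonempty X] (G : Subgroup (Perm X)) :
    Function.Injective (wrPerm (p := p) G) := by
  intro a b hab
  have key : ∀ (i : Fin p) (x : X),
      (a.right : Perm (Fin p)) i = (b.right : Perm (Fin p)) i ∧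
      (a.left ((a.right : Perm (Fin p)) i) : Perm X) x =
        (b.left ((b.right : Perm (Fin p)) i) : Perm X) x := fun i x => by
    have := congrArg (fun e : Perm (Fin p × X) => e (i, x)) hab
    exact Prod.ext_iff.mp this
  obtain ⟨x₀⟩ := ‹Nonempty X›
  have hr : a.right = b.right := Subtype.ext (Equiv.ext fun i => (key i x₀).1)
  refine SemidirectProduct.ext (funext fun i => Subtype.ext (Equiv.ext fun x => ?_)) hr
  have := (key ((a.right : Perm (Fin p))⁻¹ i) x).2
  rw [← hr] at this
  simpa using this

/-! ### The Sylow `p`-subgroups of the symmetric groups -/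

/-- The point `x` of the `i`-th block of length `p^k` is the point `i * p^k + x`. -/
def blockEquiv (p k : ℕ) : Fin p × Fin (p ^ k) ≃ Fin (p ^ (k + 1)) :=
  finProdFinEquiv.trans (finCongr (pow_succ' p k).symm)

/-- The canonical permutation representation on `p^(k+1)` points of `G ≀ C_p`, for a permutation
group `G` on `p^k` points. -/
def wrPermFin (p k : ℕ) (G : Subgroup (Perm (Fin (p ^ k)))) :
    Wr p G →* Perm (Fin (p ^ (k + 1))) :=
  (blockEquiv p k).permCongrHom.toMonoidHom.comp (wrPerm G)

/-- The Sylow `p`-subgroup `P_{p^k}` of the symmetric group on `p^k` points: `P_1` is trivial and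
`P_{p^(k+1)} = P_{p^k} ≀ C_p` (so `P_p` is generated by the `p`-cycle `x ↦ x + 1`). -/
def Syl (p : ℕ) : (k : ℕ) → Subgroup (Perm (Fin (p ^ k)))
  | 0 => ⊥
  | k + 1 => (wrPermFin p k (Syl p k)).range

theorem wrPermFin_injective (p k : ℕ) [NeZero p] (G : Subgroup (Perm (Fin (p ^ k)))) :
    Function.Injective (wrPermFin p k G) := by
  have : Nonempty (Fin (p ^ k)) := ⟨0⟩
  exact (blockEquiv p k).permCongrHom.injective.comp (wrPerm_injective G)

/-- The identification `P_{p^k} ≀ C_p = P_{p^(k+1)}`. -/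
def wrIso (p k : ℕ) [NeZero p] : Wr p (Syl p k) ≃* Syl p (k + 1) :=
  MonoidHom.ofInjective (wrPermFin_injective p k (Syl p k))

/-- The character `φ_ε` of `P_p`. -/
def linChar {p : ℕ} [NeZero p] (ε : Fin p) (x : Syl p 1) : ℂ :=
  cycChar ε ((wrIso p 0).symm x).right

/-- The character `X(φ; ε)` of `P_{p^(k+1)}`, for `φ ∈ Irr(P_{p^k})`. -/
def sylX {p : ℕ} [NeZero p] {k : ℕ} (φ : Irr (Syl p k)) (ε : Fin p) (x : Syl p (k + 1)) : ℂ :=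
  wrX φ ε ((wrIso p k).symm x)

/-- The inclusion of the base group `(P_{p^k})^p` in `P_{p^(k+1)}`. -/
def baseHom (p k : ℕ) [NeZero p] : (Fin p → Syl p k) →* Syl p (k + 1) :=
  (wrIso p k).toMonoidHom.comp SemidirectProduct.inl

/-- The character `(θ_1 × ⋯ × θ_p)↑` of `P_{p^(k+1)}`, induced from the base group. -/
def sylInd {p : ℕ} [NeZero p] {k : ℕ} (θ : Fin p → Irr (Syl p k)) : Syl p (k + 1) → ℂ :=
  induce (baseHom p k) (outer (fun i => (θ i).1))

/-- The exponents of the `p`-adic expansion of `n`, in decreasing order, each repeated as many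
times as the corresponding digit says. -/
def exponents (p n : ℕ) : List ℕ :=
  (List.range (n + 1)).reverse.flatMap fun k => List.replicate (n / p ^ k % p) k

theorem sum_digits (p n m : ℕ) :
    ((List.range m).map fun k => n / p ^ k % p * p ^ k).sum = n % p ^ m := by
  induction m with
  | zero => simp [Nat.mod_one]
  | succ m ih =>
    rw [List.range_succ, List.map_append, List.sum_append, ih, Nat.mod_pow_succ]
    simp [mul_comm]

theorem sum_exponents (p n : ℕ) [hp : Fact p.Prime] :
    ∑ j : Fin (exponents p n).length, p ^ (exponents p n)[j] = n := by
  have h1 : ∑ j : Fin (exponents p n).length, p ^ (exponents p n)[j] =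
      ((exponents p n).map (p ^ ·)).sum := by
    simp
  rw [h1, exponents, List.map_flatMap, List.flatMap_eq_foldl]
  have h2 : ∀ l : List ℕ, ((l.flatMap fun k => (List.replicate (n / p ^ k % p) k).map (p ^ ·))).sum
      = (l.map fun k => n / p ^ k % p * p ^ k).sum := by
    intro l
    induction l with
    | nil => simp
    | cons a l ih =>
      rw [List.flatMap_cons, List.sum_append, ih]
      simp
  rw [← List.flatMap_eq_foldl, h2, List.map_reverse, List.sum_reverse, sum_digits]
  exact Nat.mod_eq_of_lt ((Nat.lt_succ_self n).trans (Nat.lt_pow_self hp.out.one_lt))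

/-- The number `q` of factors of `P_n`: the sum of the `p`-adic digits of `n`. -/
abbrev numFactors (p n : ℕ) : ℕ := (exponents p n).length

/-- The exponent `o(j)` of the `j`-th factor of `P_n`. -/
abbrev expo (p n : ℕ) (j : Fin (numFactors p n)) : ℕ := (exponents p n)[j]

/-- The `n` points cut into consecutive blocks of lengths `p^{o(1)}, p^{o(2)}, …`. -/
def pointsEquiv (p n : ℕ) [Fact p.Prime] :
    (Σ j : Fin (numFactors p n), Fin (p ^ expo p n j)) ≃ Fin n :=
  finSigmaFinEquiv.trans (finCongr (sum_exponents p n))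

/-- The direct product of the `P_{p^{o(j)}}`, acting blockwise on `n` points. -/
def prodPerm (p n : ℕ) [Fact p.Prime] :
    (∀ j : Fin (numFactors p n), Syl p (expo p n j)) →* Perm (Fin n) :=
  (pointsEquiv p n).permCongrHom.toMonoidHom.comp
    ((Perm.sigmaCongrRightHom fun j => Fin (p ^ expo p n j)).comp
      (MonoidHom.pi fun j => (Syl p (expo p n j)).subtype.comp (Pi.evalMonoidHom _ j)))

/-- The Sylow `p`-subgroup `P_n` of the symmetric group on `n` points. -/
def SylN (p n : ℕ) [Fact p.Prime] : Subgroup (Perm (Fin n)) := (prodPerm p n).range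

theorem prodPerm_injective (p n : ℕ) [Fact p.Prime] : Function.Injective (prodPerm p n) := by
  refine (pointsEquiv p n).permCongrHom.injective.comp
    (Perm.sigmaCongrRightHom_injective.comp fun a b h => ?_)
  exact funext fun j => Subtype.ext (congrFun h j)

/-- The identification of `P_n` with the direct product of the `P_{p^{o(j)}}`. -/
def prodIso (p n : ℕ) [Fact p.Prime] :
    (∀ j : Fin (numFactors p n), Syl p (expo p n j)) ≃* SylN p n :=
  MonoidHom.ofInjective (prodPerm_injective p n)

/-- The character `θ_1 × ⋯ × θ_q` of `P_n`. -/
def sylOuter {p n : ℕ} [Fact p.Prime]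
    (θ : ∀ j : Fin (numFactors p n), Irr (Syl p (expo p n j))) (x : SylN p n) : ℂ :=
  outer (fun j => (θ j).1) ((prodIso p n).symm x)

/-! ### Labelling functions and tree functions -/

/-- The `p^k`-skeleton: sequences of length at most `k - 1` in `p` symbols. -/
abbrev Skel (p k : ℕ) : Type := {s : List (Fin p) // s.length < k}

/-- The `p^k`-labelling functions, with labels `0, …, p`. -/
abbrev Lab (p k : ℕ) : Type := Skel p k → Fin (p + 1)

/-- Given a cyclic permutation `γ_q` for every sequence `q`, replace the `i`-th symbol `s_i` of a
sequence `s` by its image under `γ` at the sequence `s_1 … s_{i-1}`, for each `i`. -/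
def twist {p : ℕ} : (List (Fin p) → Cyc p) → List (Fin p) → List (Fin p)
  | _, [] => []
  | γ, x :: s => (γ [] : Perm (Fin p)) x :: twist (fun q => γ (x :: q)) s

theorem length_twist {p : ℕ} (γ : List (Fin p) → Cyc p) (s : List (Fin p)) :
    (twist γ s).length = s.length := by
  induction s generalizing γ with
  | nil => rfl
  | cons x s ih => simp [twist, ih]

/-- The inverse of `twist`. -/
def untwist {p : ℕ} : (List (Fin p) → Cyc p) → List (Fin p) → List (Fin p)
  | _, [] => []
  | γ, y :: s => (γ [] : Perm (Fin p))⁻¹ y ::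
      untwist (fun q => γ ((γ [] : Perm (Fin p))⁻¹ y :: q)) s

theorem twist_one {p : ℕ} (s : List (Fin p)) : twist (fun _ => 1) s = s := by
  induction s with
  | nil => rfl
  | cons x s ih => simp [twist, ih]

theorem twist_twist {p : ℕ} (γ δ : List (Fin p) → Cyc p) (s : List (Fin p)) :
    twist γ (twist δ s) = twist (fun q => γ (twist δ q) * δ q) s := by
  induction s generalizing γ δ with
  | nil => rfl
  | cons x s ih => simp [twist, ih]

theorem untwist_eq {p : ℕ} (γ : List (Fin p) → Cyc p) (s : List (Fin p)) :
    twist (fun q => (γ (untwist γ q))⁻¹) s = untwist γ s := by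
  induction s generalizing γ with
  | nil => rfl
  | cons x s ih =>
    simp only [twist, untwist]
    refine congrArg₂ _ rfl ?_
    exact ih (fun q => γ ((γ [] : Perm (Fin p))⁻¹ x :: q))

theorem untwist_twist {p : ℕ} (γ : List (Fin p) → Cyc p) (s : List (Fin p)) :
    twist γ (untwist γ s) = s := by
  induction s generalizing γ with
  | nil => rfl
  | cons x s ih => simp [twist, untwist, ih]

/-- Two labelling functions are equivalent when they differ by cyclic reorderings, chosen at each
vertex, of the subtrees below it. (At the empty sequence this says that the labels at the root
agree; only the `γ_q` with `q` of length at most `k - 2` matter.) -/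
def LabRel {p k : ℕ} (t t' : Lab p k) : Prop :=
  ∃ γ : List (Fin p) → Cyc p,
    ∀ s : Skel p k, t s = t' ⟨twist γ s.1, (length_twist γ s.1).symm ▸ s.2⟩

theorem labRel_equivalence (p k : ℕ) : Equivalence (LabRel (p := p) (k := k)) where
  refl t := ⟨fun _ => 1, fun s => by simp only [twist_one]⟩
  symm := by
    rintro t t' ⟨γ, h⟩
    refine ⟨fun q => (γ (untwist γ q))⁻¹, fun s => ?_⟩
    rw [h]
    simp only [untwist_eq, untwist_twist]
  trans := by
    rintro t t' t'' ⟨γ, h⟩ ⟨δ, h'⟩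
    refine ⟨fun q => δ (twist γ q) * γ q, fun s => ?_⟩
    rw [h, h']
    simp only [twist_twist]

/-- The equivalence relation on `p^k`-labelling functions. -/
def labSetoid (p k : ℕ) : Setoid (Lab p k) := ⟨LabRel, labRel_equivalence p k⟩

/-- The `p^k`-tree functions: equivalence classes of labelling functions. -/
abbrev Tree (p k : ℕ) : Type := Quotient (labSetoid p k)

/-- The tree function of a labelling function. -/
abbrev cls {p k : ℕ} (t : Lab p k) : Tree p k := Quotient.mk (labSetoid p k) t

/-- The labelling subfunction of `t` of height `m` rooted at the sequence `s`:
`q ↦ t (s q)`. -/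
def sub {p k : ℕ} (t : Lab p k) (s : List (Fin p)) (m : ℕ) (h : s.length + m = k) : Lab p m :=
  fun q => t ⟨s ++ q.1, by have := q.2; simp only [List.length_append]; omega⟩

/-- Admissible labelling functions (representatives of admissible tree functions). -/
def Adm {p : ℕ} : (k : ℕ) → Lab p k → Prop
  | 0, _ => True
  | 1, t => t ⟨[], Nat.one_pos⟩ ≠ Fin.last p
  | k + 2, t =>
    (∀ s : Skel p (k + 2), s.1.length = k + 1 → t s ≠ Fin.last p) ∧
    ∀ (s : List (Fin p)) (m : ℕ) (h : s.length + 1 + (m + 1) = k + 2),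
      let child : Fin p → Lab p (m + 1) := fun i => sub t (s ++ [i]) (m + 1) (by simpa using h)
      (t ⟨s, by omega⟩ ≠ Fin.last p →
        (∀ i, Adm (m + 1) (child i)) ∧ ∀ i j, cls (child i) = cls (child j)) ∧
      (t ⟨s, by omega⟩ = Fin.last p →
        (∀ i, Adm (m + 1) (child i)) ∧ ∃ i j, cls (child i) ≠ cls (child j))
  termination_by k => k
  decreasing_by all_goals omega

/-- The admissible `p^k`-tree functions. -/
abbrev AdmTree (p k : ℕ) : Type := {T : Tree p k // ∃ t : Lab p k, cls t = T ∧ Adm k t}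

/-- The `p`-tree function `T^ε` with the single label `ε`. -/
def leaf {p : ℕ} (ε : Fin (p + 1)) : Tree p 1 := cls fun _ => ε

/-- The labelling function `(f_1 | ⋯ | f_p; ε)`. -/
def labNode {p k : ℕ} (f : Fin p → Lab p k) (ε : Fin (p + 1)) : Lab p (k + 1)
  | ⟨[], _⟩ => ε
  | ⟨i :: q, h⟩ => f i ⟨q, Nat.lt_of_succ_lt_succ h⟩

/-- The tree function `(T_1 | ⋯ | T_p; ε)`. -/
def node {p k : ℕ} (T : Fin p → Tree p k) (ε : Fin (p + 1)) : Tree p (k + 1) :=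
  cls (labNode (fun i => (T i).out) ε)

/-- The class `(T_1 | ⋯ | T_p; ε)` does not depend on the choice of representatives. -/
theorem node_cls {p k : ℕ} (f : Fin p → Lab p k) (ε : Fin (p + 1)) :
    node (fun i => cls (f i)) ε = cls (labNode f ε) := by
  have h : ∀ i, LabRel (Quotient.out (cls (f i))) (f i) := fun i =>
    Quotient.exact (s := labSetoid p k) (Quotient.out_eq (cls (f i)))
  choose γ hγ using h
  refine Quotient.sound (s := labSetoid p (k + 1)) ⟨fun q => match q with
    | [] => 1
    | i :: q => γ i q, ?_⟩
  rintro ⟨_ | ⟨i, q⟩, hs⟩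
  · rfl
  · exact hγ i ⟨q, Nat.lt_of_succ_lt_succ hs⟩

/-! ### The recursions that define `Φ` and `Ψ` -/

/-- The recursive prescription for the maps `Φ_{p^k} : Irr(P_{p^k}) → {admissible tree functions}`.
(For `k = 0` both sets have one element, and nothing is prescribed.) -/
structure IsPhi (p : ℕ) [NeZero p] (Φ : ∀ k, Irr (Syl p k) → AdmTree p k) : Prop where
  base : ∀ (θ : Irr (Syl p 1)) (ε : Fin p), θ.1 = linChar ε → (Φ 1 θ).1 = leaf ε.castSucc
  extend : ∀ k, 1 ≤ k → ∀ (θ : Irr (Syl p (k + 1))) (φ : Irr (Syl p k)) (ε : Fin p),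
    θ.1 = sylX φ ε → (Φ (k + 1) θ).1 = node (fun _ => (Φ k φ).1) ε.castSucc
  induced : ∀ k, 1 ≤ k → ∀ (θ : Irr (Syl p (k + 1))) (θs : Fin p → Irr (Syl p k)),
    (∃ i j, θs i ≠ θs j) → θ.1 = sylInd θs →
    (Φ (k + 1) θ).1 = node (fun i => (Φ k (θs i)).1) (Fin.last p)

/-- The recursive prescription for the maps `Ψ_{p^k} : {admissible tree functions} → Irr(P_{p^k})`. -/
structure IsPsi (p : ℕ) [NeZero p] (Ψ : ∀ k, AdmTree p k → Irr (Syl p k)) : Prop where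
  base : ∀ (T : AdmTree p 1) (ε : Fin p), T.1 = leaf ε.castSucc → (Ψ 1 T).1 = linChar ε
  extend : ∀ k, 1 ≤ k → ∀ (T : AdmTree p (k + 1)) (Ts : Fin p → AdmTree p k) (ε : Fin p),
    T.1 = node (fun i => (Ts i).1) ε.castSucc → (Ψ (k + 1) T).1 = sylX (Ψ k (Ts 0)) ε
  induced : ∀ k, 1 ≤ k → ∀ (T : AdmTree p (k + 1)) (Ts : Fin p → AdmTree p k),
    T.1 = node (fun i => (Ts i).1) (Fin.last p) →
    (Ψ (k + 1) T).1 = sylInd (fun i => Ψ k (Ts i))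

end SylowTree

end

open SylowTree

open Equiv

noncomputable section

namespace SylowTree

/-! ### Orthogonality and completeness of irreducible characters -/

/-! Irreducible characters of `P_{p^(k+1)}` and admissible tree functions of height `k + 1` are
parametrized by the same kind of data over level `k`: an element with a label `ε < p`, or a family
of `p` elements, not all equal, up to cyclic shift (`WrData`, `WrData.Rel`). Hence a bijection at
level `k` lifts to level `k + 1` (`WrData.liftEquiv`), and induction gives `irrTreeEquiv`. The
recursions for `Φ` and `Ψ` prescribe exactly this lift, and since the data exhaust both sides they
determine the maps.

For characters this is Clifford theory for the base group `G^p` in `G ≀ C_p`. The character `X(φ;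
ε)` is irreducible because its restriction to `G^p` is. The induced character of a non-constant
family has norm one because only the identity of `C_p` fixes the family, which is where primality
enters. Restrictions to `G^p`, values on `C_p` and inner products decide which of these characters
coincide (`wrIrr_eq_iff`).

That nothing is missing is proved without counting conjugacy classes: irreducible characters whose
span contains the indicator function of the identity are all of them
(`surjective_of_deltaOne_mem_span`). This spanning property holds for the trivial group, passes to
direct products by multilinearity, and passes from `G^p` to `G ≀ C_p` by induction of class
functions, where a constant family induces to the sum of the `X(φ; ε)` over `ε` (`sum_wrX`).

For trees, `adm_succ_iff` turns admissibility into a condition on the root and its subtrees, and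
`node_eq_iff` shows that cyclic shifts at the root are the only ambiguity. General `n` reduces to
prime powers by `irrOuter_bijective`. -/

/-- The bilinear form `|G|⁻¹ ∑ χ(g) ψ(g⁻¹)` on functions on `G`. -/
def charInner {G : Type} [Group G] [Fintype G] (χ ψ : G → ℂ) : ℂ :=
  (Nat.card G : ℂ)⁻¹ * ∑ g, χ g * ψ g⁻¹

instance natCardInvertible {G : Type} [Group G] [Finite G] : Invertible (Nat.card G : ℂ) :=
  invertibleOfNonzero (Nat.cast_ne_zero.mpr Nat.card_pos.ne')

section Irreducible

variable {G V W : Type} [Group G] [AddCommGroup V] [Module ℂ V] [AddCommGroup W] [Module ℂ W]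

/-- Pulling back a representation along a group homomorphism, where the result is irreducible. -/
theorem isIrreducible_of_comp {H : Type} [Group H] (ι : H →* G) (ρ : Representation ℂ G V)
    (h : Representation.IsIrreducible (ρ.comp ι : Representation ℂ H V)) : ρ.IsIrreducible := by
  let r : Subrepresentation ρ → Subrepresentation (ρ.comp ι : Representation ℂ H V) :=
    fun U => ⟨U.toSubmodule, fun x v hv => U.apply_mem_toSubmodule (ι x) hv⟩
  have hb : ∀ U : Subrepresentation ρ, U = ⊥ ∨ U = ⊤ := fun U => by
    rcases h.eq_bot_or_eq_top (r U) with e | e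
    · exact .inl (Subrepresentation.toSubmodule_injective
        (congrArg Subrepresentation.toSubmodule e :))
    · exact .inr (Subrepresentation.toSubmodule_injective
        (congrArg Subrepresentation.toSubmodule e :))
  refine { exists_pair_ne := ⟨⊥, ⊤, fun e => ?_⟩, eq_bot_or_eq_top := hb }
  obtain ⟨x, y, hxy⟩ := h.exists_pair_ne
  have e' : (⊥ : Submodule ℂ V) = ⊤ := congrArg Subrepresentation.toSubmodule e
  have := (Submodule.subsingleton_iff ℂ).mp (subsingleton_of_bot_eq_top e')
  exact hxy (Subrepresentation.toSubmodule_injective (Subsingleton.elim _ _))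

theorem isIrreducible_conj (e : V ≃ₗ[ℂ] W) (ρ : Representation ℂ G V) (h : ρ.IsIrreducible)
    (σ : Representation ℂ G W) (hσ : ∀ g v, σ g (e v) = e (ρ g v)) : σ.IsIrreducible := by
  let r : Subrepresentation σ → Subrepresentation ρ :=
    fun U => ⟨U.toSubmodule.comap e.toLinearMap, fun x v hv => by
      have := U.apply_mem_toSubmodule x hv
      simpa [hσ] using this⟩
  have hr : Function.Injective r := fun U U' e' => by
    refine Subrepresentation.toSubmodule_injective ?_
    exact Submodule.comap_injective_of_surjective e.surjective
      (congrArg Subrepresentation.toSubmodule e')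
  have hb : ∀ U : Subrepresentation σ, U = ⊥ ∨ U = ⊤ := fun U => by
    rcases h.eq_bot_or_eq_top (r U) with e' | e'
    · refine .inl (hr (e'.trans (Subrepresentation.toSubmodule_injective ?_)))
      exact (LinearMap.ker_eq_bot.mpr e.injective).symm
    · exact .inr (hr (e'.trans (Subrepresentation.toSubmodule_injective rfl)))
  refine { exists_pair_ne := ⟨⊥, ⊤, fun e₁ => ?_⟩, eq_bot_or_eq_top := hb }
  obtain ⟨x, y, hxy⟩ := h.exists_pair_ne
  have e' : (⊥ : Submodule ℂ W) = ⊤ := congrArg Subrepresentation.toSubmodule e₁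
  have := (Submodule.subsingleton_iff ℂ).mp (subsingleton_of_bot_eq_top e')
  have := e.toEquiv.subsingleton
  exact hxy (Subrepresentation.toSubmodule_injective (Subsingleton.elim _ _))

/-- The character of an irreducible finite-dimensional representation is in `Irr G`. -/
theorem exists_irr_of_isIrreducible [FiniteDimensional ℂ V] (ρ : Representation ℂ G V)
    (h : ρ.IsIrreducible) : ∃ φ : Irr G, φ.1 = ρ.character := by
  let e : V ≃ₗ[ℂ] (Fin (Module.finrank ℂ V) → ℂ) := (Module.finBasis ℂ V).equivFun
  let σ : Representation ℂ G (Fin (Module.finrank ℂ V) → ℂ) :=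
    (e.conjRingEquiv : _ →* _).comp ρ
  have hσ : ∀ g v, σ g (e v) = e (ρ g v) := fun g v => by
    change e (ρ g (e.symm (e v))) = _
    simp
  refine ⟨⟨ρ.character, _, σ, isIrreducible_conj e ρ h σ hσ, ?_⟩, rfl⟩
  ext g
  exact LinearMap.trace_conj' (ρ g) e

/-- Converse of Schur's lemma. By Maschke an invariant subspace `U` has an invariant complement
`U'`; the projection onto `U` along `U'` commutes with `G`, so it is a scalar `c`. It fixes `U` and
kills `U'`: `c = 0` forces `U = ⊥`, and `c ≠ 0` forces `U' = ⊥`. -/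
theorem isIrreducible_of_finrank_eq_one [Finite G] (ρ : Representation ℂ G V)
    (h : Module.finrank ℂ (Representation.IntertwiningMap ρ ρ) = 1) : ρ.IsIrreducible := by
  have hne : (1 : Representation.IntertwiningMap ρ ρ) ≠ 0 := fun e => by
    have hs : Subsingleton (Representation.IntertwiningMap ρ ρ) := ⟨fun a b => by
      rw [← one_mul a, ← one_mul b, e, zero_mul, zero_mul]⟩
    rw [Module.finrank_zero_of_subsingleton] at h
    exact zero_ne_one h
  have hscal := (finrank_eq_one_iff_of_nonzero' _ hne).mp h
  have : NeZero (Nat.card G : ℂ) := ⟨Nat.cast_ne_zero.mpr Nat.card_pos.ne'⟩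
  have hb : ∀ U : Subrepresentation ρ, U = ⊥ ∨ U = ⊤ := fun U => by
    obtain ⟨U', hU⟩ := exists_isCompl U
    have hc : IsCompl U.toSubmodule U'.toSubmodule := by
      refine IsCompl.of_eq ?_ ?_
      · exact congrArg Subrepresentation.toSubmodule hU.inf_eq_bot
      · exact congrArg Subrepresentation.toSubmodule hU.sup_eq_top
    let P := Submodule.projection _ _ hc
    have hP : ∀ g v, P (ρ g v) = ρ g (P v) := fun g v => by
      obtain ⟨⟨u, hu⟩, ⟨u', hu'⟩, rfl⟩ : ∃ (u : U.toSubmodule) (u' : U'.toSubmodule),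
          (u : V) + u' = v := by
        have hv : v ∈ U.toSubmodule ⊔ U'.toSubmodule := hc.sup_eq_top ▸ Submodule.mem_top
        obtain ⟨y, hy, z, hz, e⟩ := Submodule.mem_sup.mp hv
        exact ⟨⟨y, hy⟩, ⟨z, hz⟩, e⟩
      have e1 := Submodule.projection_apply_left hc ⟨u, hu⟩
      have e2 := Submodule.projection_apply_right hc ⟨u', hu'⟩
      have e3 := Submodule.projection_apply_left hc ⟨_, U.apply_mem_toSubmodule g hu⟩
      have e4 := Submodule.projection_apply_right hc ⟨_, U'.apply_mem_toSubmodule g hu'⟩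
      simp only [P, map_add]
      simp only at e1 e2 e3 e4
      rw [e1, e2, e3, e4]
      simp
    obtain ⟨c, hcP⟩ := hscal (P.intertwiningMap_of_isIntertwiningMap ρ ρ hP)
    have hcv : ∀ v, c • v = P v := fun v => congrArg (fun f => f v) hcP
    by_cases c0 : c = 0
    · left
      refine Subrepresentation.toSubmodule_injective ((Submodule.eq_bot_iff _).mpr fun u hu => ?_)
      exact (Submodule.projection_apply_left hc ⟨u, hu⟩).symm.trans
        ((hcv u).symm.trans (by simp [c0]))
    · right
      have : U' = ⊥ := by
        refine Subrepresentation.toSubmodule_injective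
          ((Submodule.eq_bot_iff _).mpr fun u hu => ?_)
        have := (hcv u).trans (Submodule.projection_apply_right hc ⟨u, hu⟩)
        exact (smul_eq_zero.mp this).resolve_left c0
      rw [← hU.sup_eq_top, this, sup_bot_eq]
  refine { exists_pair_ne := ⟨⊥, ⊤, fun e₁ => hne ?_⟩, eq_bot_or_eq_top := hb }
  have e' : (⊥ : Submodule ℂ V) = ⊤ := congrArg Subrepresentation.toSubmodule e₁
  have := (Submodule.subsingleton_iff ℂ).mp (subsingleton_of_bot_eq_top e')
  exact Representation.IntertwiningMap.ext (Subsingleton.elim _ _)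

/-- The norm of a character is the dimension of its endomorphism algebra. This criterion serves both
external products and induced characters. -/
theorem isIrreducible_of_charInner_eq_one [Fintype G] [FiniteDimensional ℂ V]
    (ρ : Representation ℂ G V) (h : charInner ρ.character ρ.character = 1) :
    ρ.IsIrreducible := by
  refine isIrreducible_of_finrank_eq_one ρ ?_
  have := Representation.card_inv_mul_sum_char_mul_char_eq_finrank ρ ρ
  rw [← charInner, h] at this
  exact_mod_cast this.symm

end Irreducible

/-! ### Orthonormality and completeness of irreducible characters -/

section Irr

variable {G : Type} [Group G]

theorem Irr.rep_isIrreducible (φ : Irr G) : φ.rep.IsIrreducible :=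
  φ.2.choose_spec.choose_spec.1

theorem Irr.apply_one (φ : Irr G) : φ.1 1 = φ.dim := by
  rw [← φ.rep_character, Representation.char_one]
  simp

theorem Irr.dim_pos (φ : Irr G) : 0 < φ.dim := by
  rw [Nat.pos_iff_ne_zero]
  intro h
  have : IsEmpty (Fin φ.dim) := by rw [h]; infer_instance
  obtain ⟨x, y, hxy⟩ := φ.rep_isIrreducible.exists_pair_ne
  exact hxy (Subrepresentation.toSubmodule_injective (Subsingleton.elim _ _))

theorem Irr.apply_one_ne_zero (φ : Irr G) : φ.1 1 ≠ 0 := by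
  rw [φ.apply_one]
  exact_mod_cast φ.dim_pos.ne'

theorem Irr.apply_conj (φ : Irr G) (g h : G) : φ.1 (h * g * h⁻¹) = φ.1 g := by
  rw [← φ.rep_character, Representation.char_conj]

open scoped Classical in
theorem Irr.charInner_eq [Fintype G] (φ ψ : Irr G) :
    charInner φ.1 ψ.1 = if φ = ψ then 1 else 0 := by
  have := φ.rep_isIrreducible
  have := ψ.rep_isIrreducible
  have h := Representation.char_orthonormal φ.rep ψ.rep
  rw [φ.rep_character, ψ.rep_character, ← charInner] at h
  split_ifs with e
  · subst e
    rw [h, if_pos ⟨.refl _⟩]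
  · rw [h, if_neg]
    rintro ⟨f⟩
    have := Representation.char_iso f
    rw [φ.rep_character, ψ.rep_character] at this
    exact e (Subtype.ext this.symm)

/-- The indicator function of the identity. -/
def deltaOne (G : Type) [Group G] : G → ℂ := open scoped Classical in Pi.single 1 1

/-- A family of irreducible characters whose span contains the indicator function of the
identity exhausts the irreducible characters. -/
theorem surjective_of_deltaOne_mem_span [Finite G] {S : Type*} (f : S → Irr G)
    (h : deltaOne G ∈ Submodule.span ℂ (Set.range fun s => (f s).1)) : Function.Surjective f := by
  classical
  have := Fintype.ofFinite G
  intro ψ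
  by_contra! hψ
  -- A missing `ψ` is orthogonal to the whole span, whereas its pairing with `deltaOne G` is `ψ(1) /
  -- |G|`, which is not zero.
  have key : ∀ χ ∈ Submodule.span ℂ (Set.range fun s => (f s).1), charInner χ ψ.1 = 0 := by
    intro χ hχ
    induction hχ using Submodule.span_induction with
    | mem χ hχ =>
      obtain ⟨s, rfl⟩ := hχ
      simp only [Irr.charInner_eq, if_neg (hψ s)]
    | zero => simp [charInner]
    | add χ χ' _ _ h h' =>
      unfold charInner at *
      simp only [Pi.add_apply, add_mul, Finset.sum_add_distrib, mul_add, h, h', add_zero]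
    | smul c χ _ h =>
      unfold charInner at *
      simp only [Pi.smul_apply, smul_eq_mul, mul_assoc, ← Finset.mul_sum]
      rw [mul_left_comm, h, mul_zero]
  have := key _ h
  simp only [charInner, deltaOne, Pi.single_apply, ite_mul, one_mul, zero_mul,
    Finset.sum_ite_eq', Finset.mem_univ, if_true, inv_one] at this
  exact mul_ne_zero (inv_ne_zero (Nat.cast_ne_zero.mpr Nat.card_pos.ne'))
    ψ.apply_one_ne_zero this

/-- The irreducible characters span a space that contains the indicator function of the
identity. -/
def IrrComplete (G : Type) [Group G] : Prop :=
  deltaOne G ∈ Submodule.span ℂ (Set.range (Subtype.val : Irr G → G → ℂ))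

theorem irrComplete_of_mem_span {S : Type*} (f : S → Irr G)
    (h : deltaOne G ∈ Submodule.span ℂ (Set.range fun s => (f s).1)) : IrrComplete G := by
  refine Submodule.span_mono ?_ h
  rintro _ ⟨s, rfl⟩
  exact ⟨f s, rfl⟩

/-- Transport of irreducible characters along an isomorphism of groups. -/
def irrCongr {H : Type} [Group H] (e : G ≃* H) : Irr G ≃ Irr H where
  toFun φ := ⟨φ.1 ∘ e.symm, φ.dim, φ.rep.comp e.symm.toMonoidHom,
    isIrreducible_of_comp e.toMonoidHom _ (by
      convert φ.rep_isIrreducible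
      ext g : 1
      simp), by
      rw [← φ.rep_character]
      rfl⟩
  invFun φ := ⟨φ.1 ∘ e, φ.dim, φ.rep.comp e.toMonoidHom,
    isIrreducible_of_comp e.symm.toMonoidHom _ (by
      convert φ.rep_isIrreducible
      ext g : 1
      simp), by
      rw [← φ.rep_character]
      rfl⟩
  left_inv φ := Subtype.ext (by ext; simp)
  right_inv φ := Subtype.ext (by ext; simp)

theorem IrrComplete.congr {H : Type} [Group H] (e : G ≃* H) (h : IrrComplete G) :
    IrrComplete H := by
  let L : (G → ℂ) →ₗ[ℂ] (H → ℂ) := LinearMap.funLeft ℂ ℂ e.symm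
  have h1 : L (deltaOne G) = deltaOne H := by
    classical
    ext x
    simp [L, deltaOne, LinearMap.funLeft_apply, Pi.single_apply]
  have h2 := Submodule.mem_map_of_mem (f := L) h
  rw [h1, Submodule.map_span] at h2
  refine Submodule.span_mono ?_ h2
  rintro _ ⟨_, ⟨φ, rfl⟩, rfl⟩
  exact ⟨irrCongr e φ, rfl⟩

/-- The trivial character. -/
def irrOne (G : Type) [Group G] : Irr G :=
  ⟨fun _ => 1, 1, Representation.trivial ℂ G (Fin 1 → ℂ), by
    have hb : ∀ U : Subrepresentation (Representation.trivial ℂ G (Fin 1 → ℂ)),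
        U = ⊥ ∨ U = ⊤ := fun U => by
      have : IsSimpleModule ℂ (Fin 1 → ℂ) := by
        rw [isSimpleModule_iff_finrank_eq_one]
        simp
      rcases eq_bot_or_eq_top U.toSubmodule with h | h
      · exact .inl (Subrepresentation.toSubmodule_injective h)
      · exact .inr (Subrepresentation.toSubmodule_injective h)
    refine { exists_pair_ne := ⟨⊥, ⊤, fun e => ?_⟩, eq_bot_or_eq_top := hb }
    have e' : (⊥ : Submodule ℂ (Fin 1 → ℂ)) = ⊤ := congrArg Subrepresentation.toSubmodule e
    exact bot_ne_top e', by
    ext g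
    simp [Representation.character]⟩

theorem span_irrOne_of_subsingleton [Subsingleton G] :
    deltaOne G ∈ Submodule.span ℂ (Set.range fun _ : Unit => (irrOne G).1) := by
  refine Submodule.subset_span ⟨(), ?_⟩
  ext g
  simp [deltaOne, irrOne, Subsingleton.elim g 1]

theorem irr_subsingleton [Subsingleton G] (φ ψ : Irr G) : φ = ψ := by
  have h := surjective_of_deltaOne_mem_span _ (span_irrOne_of_subsingleton (G := G))
  obtain ⟨_, h1⟩ := h φ
  obtain ⟨_, h2⟩ := h ψ
  rw [← h1, ← h2]

end Irr

/-! ### External products -/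

section Outer

open scoped TensorProduct

/-- The matrix entries of an endomorphism `e_b ↦ ⨂ f i e_{b (σ⁻¹ i)}` of a tensor power. -/
theorem trace_map_comp_reindex {ι V : Type} [Fintype ι] [DecidableEq ι] [AddCommGroup V]
    [Module ℂ V] {κ : Type} [Fintype κ] (b : Module.Basis κ ℂ V) (f : ι → V →ₗ[ℂ] V)
    (σ : Perm ι) :
    LinearMap.trace ℂ (⨂[ℂ] _ : ι, V) (PiTensorProduct.map f ∘ₗ
      (PiTensorProduct.reindex ℂ (fun _ : ι => V) σ).toLinearMap) =
    ∑ a : ι → κ, ∏ i, b.repr (f i (b (a (σ⁻¹ i)))) (a i) := by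
  classical
  rw [LinearMap.trace_eq_matrix_trace ℂ (Basis.piTensorProduct fun _ : ι => b)]
  refine Finset.sum_congr rfl fun a _ => ?_
  rw [Matrix.diag_apply, LinearMap.toMatrix_apply]
  have h : (PiTensorProduct.map f ∘ₗ
      (PiTensorProduct.reindex ℂ (fun _ : ι => V) σ).toLinearMap)
      (Basis.piTensorProduct (fun _ : ι => b) a) =
      PiTensorProduct.tprod ℂ fun i => f i (b (a (σ⁻¹ i))) := by
    rw [Basis.piTensorProduct_apply, LinearMap.comp_apply, LinearEquiv.coe_coe,
      PiTensorProduct.reindex_tprod, PiTensorProduct.map_tprod]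
    rfl
  rw [h, Basis.piTensorProduct_repr_tprod_apply]

theorem trace_piTensorProduct_map {m : ℕ} {V : Fin m → Type} [∀ i, AddCommGroup (V i)]
    [∀ i, Module ℂ (V i)] [∀ i, FiniteDimensional ℂ (V i)] (f : ∀ i, V i →ₗ[ℂ] V i) :
    LinearMap.trace ℂ (⨂[ℂ] i, V i) (PiTensorProduct.map f) =
      ∏ i, LinearMap.trace ℂ (V i) (f i) := by
  classical
  let b := fun i => Module.finBasis ℂ (V i)
  rw [LinearMap.trace_eq_matrix_trace ℂ (Basis.piTensorProduct b)]
  simp only [fun i => LinearMap.trace_eq_matrix_trace ℂ (b i), Matrix.trace, Matrix.diag_apply,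
    LinearMap.toMatrix_apply]
  rw [Fintype.prod_sum]
  refine Finset.sum_congr rfl fun a _ => ?_
  rw [Basis.piTensorProduct_apply, PiTensorProduct.map_tprod,
    Basis.piTensorProduct_repr_tprod_apply]

/-- `outer` is multilinear: expand a product of linear combinations. -/
theorem outer_mem_span {m : ℕ} {G : Fin m → Type} (S : ∀ i, Set (G i → ℂ)) (χ : ∀ i, G i → ℂ)
    (h : ∀ i, χ i ∈ Submodule.span ℂ (S i)) :
    outer χ ∈ Submodule.span ℂ {F | ∃ ψ : ∀ i, G i → ℂ, (∀ i, ψ i ∈ S i) ∧ F = outer ψ} := by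
  classical
  have h' := fun i => Submodule.mem_span_set'.mp (h i)
  choose n c s hs using h'
  have e : outer χ = ∑ a : ∀ i, Fin (n i), (∏ i, c i (a i)) • outer fun i => (s i (a i)).1 := by
    ext g
    simp only [outer, Finset.sum_apply, Pi.smul_apply, smul_eq_mul, ← Finset.prod_mul_distrib]
    refine Eq.trans ?_ (Fintype.prod_sum fun i j => c i j * (s i j).1 (g i))
    refine Finset.prod_congr rfl fun i _ => ?_
    rw [← hs i]
    simp
  rw [e]
  exact Submodule.sum_mem _ fun a _ => Submodule.smul_mem _ _
    (Submodule.subset_span ⟨_, fun i => (s i (a i)).2, rfl⟩)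

variable {m : ℕ} {G : Fin m → Type} [∀ i, Group (G i)]

/-- The external tensor product of representations. -/
def outerRep {V : Fin m → Type} [∀ i, AddCommGroup (V i)] [∀ i, Module ℂ (V i)]
    (ρ : ∀ i, Representation ℂ (G i) (V i)) : Representation ℂ (∀ i, G i) (⨂[ℂ] i, V i) where
  toFun g := PiTensorProduct.map fun i => ρ i (g i)
  map_one' := by
    simp only [Pi.one_apply, map_one]
    exact PiTensorProduct.map_one
  map_mul' a b := by
    simp only [Pi.mul_apply, map_mul]
    exact PiTensorProduct.map_mul _ _

theorem outerRep_character {V : Fin m → Type} [∀ i, AddCommGroup (V i)] [∀ i, Module ℂ (V i)]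
    [∀ i, FiniteDimensional ℂ (V i)] (ρ : ∀ i, Representation ℂ (G i) (V i)) :
    (outerRep ρ).character = outer fun i => (ρ i).character := by
  ext g
  exact trace_piTensorProduct_map _

theorem charInner_outer [∀ i, Fintype (G i)] (χ ψ : ∀ i, G i → ℂ) :
    charInner (outer χ) (outer ψ) = ∏ i, charInner (χ i) (ψ i) := by
  simp only [charInner, outer, ← Finset.prod_mul_distrib]
  rw [Finset.prod_mul_distrib, Fintype.prod_sum, Nat.card_pi, Nat.cast_prod,
    Finset.prod_inv_distrib]
  simp

open scoped Classical in
theorem charInner_outer_irr [∀ i, Fintype (G i)] (θ θ' : ∀ i, Irr (G i)) :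
    charInner (outer fun i => (θ i).1) (outer fun i => (θ' i).1) = if θ = θ' then 1 else 0 := by
  rw [charInner_outer]
  simp only [Irr.charInner_eq, Fintype.prod_ite_zero, Finset.prod_const_one, funext_iff]

/-- Distinct families have orthogonal external products, each of norm one. -/
theorem outer_injective [∀ i, Finite (G i)] :
    Function.Injective fun (θ : ∀ i, Irr (G i)) => outer fun i => (θ i).1 := by
  classical
  have := fun i => Fintype.ofFinite (G i)
  intro θ θ' h
  have h1 := charInner_outer_irr θ θ
  have h2 := charInner_outer_irr θ θ'
  simp only at h
  rw [← h, h1, if_pos rfl] at h2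
  by_contra hne
  rw [if_neg hne] at h2
  exact one_ne_zero h2

instance piTensorProduct_finite {V : Fin m → Type} [∀ i, AddCommGroup (V i)]
    [∀ i, Module ℂ (V i)] [∀ i, FiniteDimensional ℂ (V i)] :
    FiniteDimensional ℂ (⨂[ℂ] i, V i) :=
  Module.Basis.finiteDimensional_of_finite
    (Basis.piTensorProduct fun i => Module.finBasis ℂ (V i))

theorem outerRep_rep_character (θ : ∀ i, Irr (G i)) :
    (outerRep fun i => (θ i).rep).character = outer fun i => (θ i).1 := by
  rw [outerRep_character]
  simp only [Irr.rep_character]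

theorem outerRep_isIrreducible [∀ i, Finite (G i)] (θ : ∀ i, Irr (G i)) :
    (outerRep fun i => (θ i).rep).IsIrreducible := by
  classical
  have := fun i => Fintype.ofFinite (G i)
  refine isIrreducible_of_charInner_eq_one _ ?_
  rw [outerRep_rep_character, charInner_outer_irr, if_pos rfl]

/-- The external product of irreducible characters. -/
def irrOuter [∀ i, Finite (G i)] (θ : ∀ i, Irr (G i)) : Irr (∀ i, G i) :=
  ⟨outer fun i => (θ i).1, by
    obtain ⟨φ, hφ⟩ := exists_irr_of_isIrreducible _ (outerRep_isIrreducible θ)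
    rw [← outerRep_rep_character, ← hφ]
    exact φ.2⟩

theorem outer_deltaOne : outer (fun i => deltaOne (G i)) = deltaOne (∀ i, G i) := by
  classical
  ext g
  simp only [outer, deltaOne, Pi.single_apply, Fintype.prod_ite_zero, Finset.prod_const_one,
    funext_iff, Pi.one_apply]

theorem deltaOne_mem_span_outer (h : ∀ i, IrrComplete (G i)) :
    deltaOne (∀ i, G i) ∈
      Submodule.span ℂ (Set.range fun θ : ∀ i, Irr (G i) => outer fun i => (θ i).1) := by
  rw [← outer_deltaOne]
  refine Submodule.span_mono ?_ (outer_mem_span _ _ h)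
  rintro _ ⟨ψ, hψ, rfl⟩
  choose θ hθ using hψ
  exact ⟨θ, by simp only [hθ]⟩

theorem irrOuter_bijective [∀ i, Finite (G i)] (h : ∀ i, IrrComplete (G i)) :
    Function.Bijective (irrOuter : (∀ i, Irr (G i)) → Irr (∀ i, G i)) :=
  ⟨fun _ _ e => outer_injective (congrArg Subtype.val e),
    surjective_of_deltaOne_mem_span _ (deltaOne_mem_span_outer h)⟩

end Outer

/-! ### The cyclic group of order `p` -/

section Cyclic

variable {p : ℕ} [NeZero p]

/-- Elements of `C_p` commute with the rotation `i ↦ i + 1`, hence are translations. So `C_p` acts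
regularly and `h` is encoded by `h 0`. -/
theorem cyc_apply (h : Cyc p) (i : Fin p) :
    (h : Perm (Fin p)) i = i + (h : Perm (Fin p)) 0 := by
  have hc : Commute (h : Perm (Fin p)) (finRotate p) := by
    obtain ⟨k, hk⟩ := Subgroup.mem_zpowers_iff.mp h.2
    rw [← hk]
    exact (Commute.refl _).zpow_left k
  have h1 : ∀ i, (h : Perm (Fin p)) (i + 1) = (h : Perm (Fin p)) i + 1 := fun i => by
    rw [← finRotate_apply, ← finRotate_apply]
    exact congrArg (fun e : Perm (Fin p) => e i) hc
  have h2 : ∀ n : ℕ, (h : Perm (Fin p)) (Fin.ofNat p n) =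
      Fin.ofNat p n + (h : Perm (Fin p)) 0 := by
    intro n
    induction n with
    | zero => simp
    | succ n ih =>
      have : Fin.ofNat p (n + 1) = Fin.ofNat p n + 1 := by
        apply Fin.ext
        simp [Fin.val_add]
      rw [this, h1, ih, add_right_comm]
  simpa using h2 i

theorem exists_cyc_apply_zero (a : Fin p) : ∃ h : Cyc p, (h : Perm (Fin p)) 0 = a := by
  have : ∀ n : ℕ, ((finRotate p) ^ n) 0 = Fin.ofNat p n := by
    intro n
    induction n with
    | zero => simp
    | succ n ih =>
      rw [pow_succ', Perm.mul_apply, ih, finRotate_apply]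
      apply Fin.ext
      simp [Fin.val_add]
  refine ⟨⟨finRotate p ^ (a : ℕ), Subgroup.npow_mem_zpowers _ _⟩, ?_⟩
  simp [this]

/-- An element of the cyclic group is determined by the image of `0`. -/
def cycEquiv : Cyc p ≃ Fin p :=
  Equiv.ofBijective (fun h => (h : Perm (Fin p)) 0)
    ⟨fun g h e => Subtype.ext (Equiv.ext fun i => by
      rw [cyc_apply g, cyc_apply h]
      exact congrArg _ e), exists_cyc_apply_zero⟩

theorem card_cyc : Nat.card (Cyc p) = p := by
  rw [Nat.card_congr cycEquiv, Nat.card_fin]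

theorem exp_pow_self (p : ℕ) [NeZero p] : Complex.exp (2 * Real.pi * Complex.I / p) ^ p = 1 :=
  (Complex.isPrimitiveRoot_exp p (NeZero.ne p)).pow_eq_one

theorem cycChar_one (ε : Fin p) : cycChar ε 1 = 1 := by
  simp [cycChar]

theorem cycChar_mul (ε : Fin p) (g h : Cyc p) :
    cycChar ε (g * h) = cycChar ε g * cycChar ε h := by
  have e : ((g * h : Cyc p) : Perm (Fin p)) 0 =
      (h : Perm (Fin p)) 0 + (g : Perm (Fin p)) 0 := by
    rw [Subgroup.coe_mul, Perm.mul_apply, cyc_apply]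
  -- Addition in `Fin p` reduces modulo `p`; this identity absorbs the reduction in the exponent.
  have hp : (Complex.exp (2 * Real.pi * Complex.I / p) ^ (ε : ℕ)) ^ p = 1 := by
    rw [← pow_mul, mul_comm (ε : ℕ), pow_mul, exp_pow_self, one_pow]
  unfold cycChar
  rw [e, Fin.val_add, pow_mul, ← pow_eq_pow_mod _ hp, pow_add, pow_mul, pow_mul, mul_comm]

theorem cycChar_injective (hp : 1 < p) :
    Function.Injective (cycChar : Fin p → Cyc p → ℂ) := by
  intro ε ε' h
  obtain ⟨g, hg⟩ := exists_cyc_apply_zero (1 : Fin p)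
  have := congrFun h g
  have h1 : ((1 : Fin p) : ℕ) = 1 := by
    rw [Fin.val_one', Nat.mod_eq_of_lt hp]
  simp only [cycChar, hg, h1, mul_one] at this
  exact Fin.ext ((Complex.isPrimitiveRoot_exp p (NeZero.ne p)).pow_inj ε.2 ε'.2 this)

end Cyclic

section Prime

variable {p : ℕ} [hp : Fact p.Prime]

open scoped Classical in
theorem sum_cycChar (h : Cyc p) : ∑ ε : Fin p, cycChar ε h = if h = 1 then (p : ℂ) else 0 := by
  split_ifs with e
  · subst e
    simp [cycChar_one]
  · have h0 : (h : Perm (Fin p)) 0 ≠ 0 := fun h0 => e (cycEquiv.injective h0)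
    -- Primality makes `ω ^ (h 0)` again a primitive `p`-th root of unity, so its geometric sum
    -- vanishes.
    have hc : ((h : Perm (Fin p)) 0 : ℕ).Coprime p := by
      refine (Nat.Coprime.symm ?_)
      rw [Nat.Prime.coprime_iff_not_dvd hp.out]
      intro hd
      exact h0 (Fin.ext (Nat.eq_zero_of_dvd_of_lt hd (Fin.is_lt _)))
    have hω := (Complex.isPrimitiveRoot_exp p (NeZero.ne p)).pow_of_coprime _ hc
    have := hω.geom_sum_eq_zero hp.out.one_lt
    rw [← this, ← Fin.sum_univ_eq_sum_range]
    refine Finset.sum_congr rfl fun ε _ => ?_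
    rw [cycChar, ← pow_mul, mul_comm (ε : ℕ)]

/-- Only the identity of `C_p` fixes a non-constant family of `p` elements. -/
theorem cyc_eq_one_of_comp_eq {X : Type*} (θ : Fin p → X) (hθ : ∃ i j, θ i ≠ θ j) (c : Cyc p)
    (h : ∀ i, θ ((c : Perm (Fin p)) i) = θ i) : c = 1 := by
  have : Fact (Nat.card (Cyc p)).Prime := ⟨by
    rw [card_cyc]
    exact hp.out⟩
  -- The stabilizer of `θ` in a group of prime order is trivial or everything, and in the second
  -- case transitivity would make `θ` constant.
  let H : Subgroup (Cyc p) :=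
    { carrier := {c | ∀ i, θ ((c : Perm (Fin p)) i) = θ i}
      one_mem' := fun _ => rfl
      mul_mem' := fun {a b} ha hb i => (ha _).trans (hb i)
      inv_mem' := fun {a} ha i => by
        rw [← ha]
        simp }
  rcases H.eq_bot_or_eq_top_of_prime_card with e | e
  · exact Subgroup.mem_bot.mp (e ▸ (show c ∈ H from h))
  · obtain ⟨i, j, hij⟩ := hθ
    have h0 : ∀ i, θ i = θ 0 := fun i => by
      obtain ⟨a, ha⟩ := exists_cyc_apply_zero i
      have : a ∈ H := e ▸ Subgroup.mem_top a
      rw [← ha]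
      exact this 0
    exact absurd ((h0 i).trans (h0 j).symm) hij

end Prime

/-! ### Irreducible characters of the wreath product `G ≀ C_p` -/

section Extension

variable {p : ℕ} {G : Type} [Group G]

instance wr_finite [Finite G] : Finite (Wr p G) :=
  Finite.of_equiv _ SemidirectProduct.equivProd.symm

theorem inl_left_eq (w : Wr p G) (h : w.right = 1) : SemidirectProduct.inl w.left = w :=
  SemidirectProduct.ext rfl h.symm

theorem tensorExt_inl {V : Type} [AddCommGroup V] [Module ℂ V] (ρ : Representation ℂ G V)
    (n : Fin p → G) :
    tensorExt (p := p) ρ (SemidirectProduct.inl n) = outerRep (fun _ => ρ) n := by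
  ext v
  simp [tensorExt, outerRep, PiTensorProduct.reindex_tprod]
  rfl

/-- The trace of a cyclic permutation of the tensor factors is a positive integer. -/
theorem tensorExt_character_inr_ne_zero {n : ℕ} (hn : 0 < n)
    (ρ : Representation ℂ G (Fin n → ℂ)) (h : Cyc p) :
    (tensorExt (p := p) ρ).character (SemidirectProduct.inr h) ≠ 0 := by
  classical
  -- A permutation matrix has as trace its number of fixed basis vectors, here the index functions
  -- invariant under `h`; a constant function is one of them.
  have e : (tensorExt (p := p) ρ).character (SemidirectProduct.inr h) =
      ((Finset.univ.filter fun a : Fin p → Fin n =>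
        ∀ i, a ((h : Perm (Fin p))⁻¹ i) = a i).card : ℂ) := by
    refine (trace_map_comp_reindex (Pi.basisFun ℂ (Fin n)) _ _).trans ?_
    rw [Finset.card_filter, Nat.cast_sum]
    refine Finset.sum_congr rfl fun a _ => ?_
    simp [Pi.single_apply, Fintype.prod_ite_zero, eq_comm]
  rw [e, Nat.cast_ne_zero]
  exact (Finset.card_pos.mpr ⟨fun _ => ⟨0, hn⟩, by simp⟩).ne'

variable [NeZero p]

theorem cycChar_ne_zero (ε : Fin p) (h : Cyc p) : cycChar ε h ≠ 0 :=
  pow_ne_zero _ (Complex.exp_ne_zero _)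

theorem wrX_inl (φ : Irr G) (ε : Fin p) (n : Fin p → G) :
    wrX φ ε (SemidirectProduct.inl n : Wr p G) = outer (fun _ => φ.1) n := by
  rw [wrX, Representation.character, tensorExt_inl, SemidirectProduct.right_inl, cycChar_one,
    mul_one, ← Representation.character, outerRep_rep_character]

theorem wrX_inr_ne_zero (φ : Irr G) (ε : Fin p) (h : Cyc p) :
    wrX φ ε (SemidirectProduct.inr h : Wr p G) ≠ 0 :=
  mul_ne_zero (tensorExt_character_inr_ne_zero φ.dim_pos _ _) (cycChar_ne_zero _ _)

/-- The representation of `G ≀ C_p` that affords `X(φ; ε)`. -/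
def wrRep (φ : Irr G) (ε : Fin p) :
    Representation ℂ (Wr p G) (PiTensorProduct ℂ fun _ : Fin p => (Fin φ.dim → ℂ)) where
  toFun w := cycChar ε w.right • tensorExt φ.rep w
  map_one' := by rw [SemidirectProduct.one_right, cycChar_one, one_smul, map_one]
  map_mul' a b := by
    rw [SemidirectProduct.mul_right, cycChar_mul, map_mul, smul_mul_smul_comm]

theorem wrRep_character (φ : Irr G) (ε : Fin p) : (wrRep φ ε).character = wrX φ ε := by
  ext w
  rw [wrX, mul_comm]
  exact (LinearMap.trace ℂ _).map_smul _ _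

/-- The restriction to the base group is already irreducible: it is an external tensor power of an
irreducible representation. -/
theorem wrRep_isIrreducible [Finite G] (φ : Irr G) (ε : Fin p) :
    (wrRep φ ε).IsIrreducible := by
  refine isIrreducible_of_comp SemidirectProduct.inl _ ?_
  have h := outerRep_isIrreducible fun _ : Fin p => φ
  rwa [show (outerRep fun _ : Fin p => φ.rep) = (wrRep φ ε).comp SemidirectProduct.inl from ?_]
    at h
  refine MonoidHom.ext fun n => Eq.symm ?_
  change cycChar ε (SemidirectProduct.inl n : Wr p G).right • tensorExt φ.rep _ = _
  rw [SemidirectProduct.right_inl, cycChar_one, one_smul, tensorExt_inl]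

/-- The restriction to the base group recovers `φ`. On `C_p` the trace of the tensor power never
vanishes, so it can be cancelled, leaving `φ_ε`. -/
theorem wrX_injective [Finite G] (hp : 1 < p) {φ φ' : Irr G} {ε ε' : Fin p}
    (h : (wrX φ ε : Wr p G → ℂ) = wrX φ' ε') : φ = φ' ∧ ε = ε' := by
  have h1 : φ = φ' := by
    have : (fun _ : Fin p => φ) = fun _ => φ' := outer_injective (by
      ext n
      exact (wrX_inl φ ε n).symm.trans ((congrFun h _).trans (wrX_inl φ' ε' n)))
    exact congrFun this 0
  subst h1
  refine ⟨rfl, cycChar_injective hp (funext fun c => ?_)⟩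
  exact mul_left_cancel₀ (tensorExt_character_inr_ne_zero φ.dim_pos φ.rep c)
    (congrFun h (SemidirectProduct.inr c))

end Extension

/-! ### Induction from the base group -/

section Induction

theorem outer_comp_perm {p : ℕ} {G : Type} (θ : Fin p → G → ℂ) (n : Fin p → G) (x : Perm (Fin p)) :
    outer θ (fun i => n (x i)) = outer (fun i => θ (x⁻¹ i)) n := by
  unfold outer
  exact Fintype.prod_equiv x _ _ fun i => by simp

variable {p : ℕ} {G : Type} [Group G]

open scoped Classical in
/-- Explicit form of induction from the base group `G^p` to `G ≀ C_p`. -/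
def wrInd : ((Fin p → G) → ℂ) →ₗ[ℂ] (Wr p G → ℂ) where
  toFun χ w := if w.right = 1 then
    ∑ x : Cyc p, χ (fun i => w.left ((x : Perm (Fin p)) i)) else 0
  map_add' χ ψ := by
    ext w
    by_cases h : w.right = 1 <;> simp [h, Finset.sum_add_distrib]
  map_smul' c χ := by
    ext w
    by_cases h : w.right = 1 <;> simp [h, Finset.mul_sum]

theorem wrInd_inl (χ : (Fin p → G) → ℂ) (n : Fin p → G) :
    wrInd χ (SemidirectProduct.inl n) = ∑ x : Cyc p, χ (fun i => n ((x : Perm (Fin p)) i)) :=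
  if_pos rfl

theorem wrInd_of_right_ne_one (χ : (Fin p → G) → ℂ) (w : Wr p G) (h : w.right ≠ 1) :
    wrInd χ w = 0 :=
  if_neg h

theorem sum_wr [Fintype G] [Fintype (Wr p G)] (f : Wr p G → ℂ) :
    ∑ w, f w = ∑ n : Fin p → G, ∑ x : Cyc p,
      f (SemidirectProduct.inl n * SemidirectProduct.inr x) := by
  rw [← Fintype.sum_prod_type']
  exact Fintype.sum_equiv SemidirectProduct.equivProd _ _ fun w => by
    simp [SemidirectProduct.equivProd]

theorem extend_inl_eq_zero (χ : (Fin p → G) → ℂ) (w : Wr p G) (h : w.right ≠ 1) :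
    Function.extend (SemidirectProduct.inl : _ →* Wr p G) χ 0 w = 0 := by
  rw [Function.extend_apply']
  · rfl
  · rintro ⟨n, rfl⟩
    exact h rfl

/-- The base group is normal with complement `C_p`. Conjugation by its own elements does not change
`χ`, so the sum over them cancels the factor `|G^p|⁻¹` and only the sum over `C_p` remains. -/
theorem induce_inl [Finite G] (χ : (Fin p → G) → ℂ)
    (hχ : ∀ m n, χ (m⁻¹ * n * m) = χ n) :
    induce (SemidirectProduct.inl : _ →* Wr p G) χ = wrInd χ := by
  classical
  have := Fintype.ofFinite G
  have := Fintype.ofFinite (Wr p G)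
  ext w
  rw [induce, finsum_eq_sum_of_fintype, sum_wr]
  by_cases h : w.right = 1
  · obtain ⟨n, rfl⟩ : ∃ n, SemidirectProduct.inl n = w := ⟨_, inl_left_eq w h⟩
    have key : ∀ (m : Fin p → G) (x : Cyc p),
        Function.extend (SemidirectProduct.inl : _ →* Wr p G) χ 0
          ((SemidirectProduct.inl m * SemidirectProduct.inr x)⁻¹ * SemidirectProduct.inl n *
            (SemidirectProduct.inl m * SemidirectProduct.inr x)) =
        χ (fun i => n ((x : Perm (Fin p)) i)) := fun m x => by
      have e : ((SemidirectProduct.inl m * SemidirectProduct.inr x)⁻¹ * SemidirectProduct.inl n *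
            (SemidirectProduct.inl m * SemidirectProduct.inr x) : Wr p G) =
          SemidirectProduct.inl ((mulAutArrow x⁻¹ : MulAut (Fin p → G)) (m⁻¹ * n * m)) := by
        rw [SemidirectProduct.inl_aut]
        simp [mul_assoc]
      rw [e, SemidirectProduct.inl_injective.extend_apply, map_mul, map_mul, map_inv, hχ]
      congr 1
    simp only [key]
    rw [wrInd_inl, Finset.sum_const, Finset.card_univ, nsmul_eq_mul, ← Nat.card_eq_fintype_card,
      inv_mul_cancel_left₀ (Nat.cast_ne_zero.mpr Nat.card_pos.ne')]
  · rw [wrInd_of_right_ne_one _ _ h]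
    refine mul_eq_zero_of_right _ (Finset.sum_eq_zero fun m _ => Finset.sum_eq_zero fun x _ =>
      extend_inl_eq_zero _ _ fun e => h ?_)
    simpa [mul_assoc, inv_mul_eq_one] using e

/-- The induced representation, on functions from `C_p`. -/
def wrIndRep {V : Type} [AddCommGroup V] [Module ℂ V] (ρ : Representation ℂ (Fin p → G) V) :
    Representation ℂ (Wr p G) (Cyc p → V) where
  toFun w := LinearMap.pi fun x =>
    ρ (fun i => w.left ((x : Perm (Fin p)) i)) ∘ₗ LinearMap.proj (w.right⁻¹ * x)
  map_one' := by
    refine LinearMap.ext fun v => funext fun x => ?_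
    have : (fun i => (1 : Wr p G).left ((x : Perm (Fin p)) i)) = 1 := rfl
    change ρ (fun i => (1 : Wr p G).left ((x : Perm (Fin p)) i))
      (v ((1 : Wr p G).right⁻¹ * x)) = v x
    rw [this, map_one, SemidirectProduct.one_right, inv_one, one_mul]
    rfl
  map_mul' a b := by
    refine LinearMap.ext fun f => funext fun x => ?_
    have : (fun i => (a * b).left ((x : Perm (Fin p)) i)) =
        (fun i => a.left ((x : Perm (Fin p)) i)) *
          fun i => b.left (((a.right⁻¹ * x : Cyc p) : Perm (Fin p)) i) := rfl
    change ρ (fun i => (a * b).left ((x : Perm (Fin p)) i)) (f ((a * b).right⁻¹ * x)) =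
      ρ (fun i => a.left ((x : Perm (Fin p)) i))
        (ρ (fun i => b.left (((a.right⁻¹ * x : Cyc p) : Perm (Fin p)) i))
          (f (b.right⁻¹ * (a.right⁻¹ * x))))
    rw [this, map_mul, SemidirectProduct.mul_right, mul_inv_rev, mul_assoc]
    rfl

/-- In the blocks indexed by `C_p`, an element acts as a block permutation matrix. Outside the base
group the permutation of blocks has no fixed point, so the diagonal is zero. -/
theorem wrIndRep_character {V : Type} [AddCommGroup V] [Module ℂ V] [FiniteDimensional ℂ V]
    (ρ : Representation ℂ (Fin p → G) V) : (wrIndRep ρ).character = wrInd ρ.character := by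
  classical
  ext w
  let b := Module.finBasis ℂ V
  rw [Representation.character,
    LinearMap.trace_eq_matrix_trace ℂ (Pi.basis fun _ : Cyc p => b), Matrix.trace,
    Fintype.sum_sigma]
  by_cases h : w.right = 1
  · obtain ⟨n, rfl⟩ : ∃ n, SemidirectProduct.inl n = w := ⟨_, inl_left_eq w h⟩
    rw [wrInd_inl]
    refine Finset.sum_congr rfl fun x _ => ?_
    rw [Representation.character, LinearMap.trace_eq_matrix_trace ℂ b, Matrix.trace]
    refine Finset.sum_congr rfl fun j _ => ?_
    simp [LinearMap.toMatrix_apply, wrIndRep, Pi.basis_apply, Pi.basis_repr]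
  · rw [wrInd_of_right_ne_one _ _ h]
    refine Finset.sum_eq_zero fun x _ => Finset.sum_eq_zero fun j _ => ?_
    have hx : w.right⁻¹ * x ≠ x := by simpa using h
    simp [LinearMap.toMatrix_apply, wrIndRep, Pi.basis_apply, Pi.basis_repr, hx]

theorem wrInd_outer_comp (θ : Fin p → G → ℂ) (c : Cyc p) :
    wrInd (outer fun i => θ ((c : Perm (Fin p)) i)) = wrInd (outer θ) := by
  ext w
  by_cases h : w.right = 1
  · rw [← inl_left_eq w h, wrInd_inl, wrInd_inl]
    refine Fintype.sum_equiv (Equiv.mulRight c⁻¹) _ _ fun x => ?_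
    rw [outer_comp_perm, outer_comp_perm]
    simp
  · rw [wrInd_of_right_ne_one _ _ h, wrInd_of_right_ne_one _ _ h]

end Induction

/-! ### Inner products of induced characters -/

section Classification

variable {p : ℕ} [hp : Fact p.Prime] {G : Type} [Group G]

-- Mackey's formula in this case: both characters vanish off the base group, and there each is the
-- sum of the cyclic shifts of an external product. Orthonormality counts the pairs of shifts that
-- agree.
open scoped Classical in
theorem charInner_wrInd_outer [Fintype G] [Fintype (Wr p G)] (θ θ' : Fin p → Irr G) :
    charInner (wrInd (outer fun i => (θ i).1)) (wrInd (outer fun i => (θ' i).1)) =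
      (p : ℂ)⁻¹ * ∑ x : Cyc p, ∑ y : Cyc p,
        if (fun i => θ ((x : Perm (Fin p))⁻¹ i)) = (fun i => θ' ((y : Perm (Fin p))⁻¹ i))
          then 1 else 0 := by
  rw [charInner, sum_wr, SemidirectProduct.card, card_cyc, Nat.cast_mul, mul_inv,
    mul_comm _ (p : ℂ)⁻¹, mul_assoc]
  congr 1
  have e : ∀ n : Fin p → G, ∑ c : Cyc p,
      wrInd (outer fun i => (θ i).1) (SemidirectProduct.inl n * SemidirectProduct.inr c) *
        wrInd (outer fun i => (θ' i).1) (SemidirectProduct.inl n * SemidirectProduct.inr c)⁻¹ =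
      ∑ x : Cyc p, ∑ y : Cyc p, (outer fun i => (θ ((x : Perm (Fin p))⁻¹ i)).1) n *
        (outer fun i => (θ' ((y : Perm (Fin p))⁻¹ i)).1) n⁻¹ := fun n => by
    rw [Finset.sum_eq_single 1]
    · rw [map_one, mul_one, ← map_inv, wrInd_inl, wrInd_inl, Finset.sum_mul_sum]
      simp only [outer_comp_perm]
    · intro c _ hc
      rw [wrInd_of_right_ne_one _ _ (by simpa using hc), zero_mul]
    · simp
  simp only [e]
  rw [Finset.sum_comm, Finset.mul_sum]
  refine Finset.sum_congr rfl fun x _ => ?_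
  rw [Finset.sum_comm, Finset.mul_sum]
  refine Finset.sum_congr rfl fun y _ => ?_
  exact charInner_outer_irr (fun i => θ ((x : Perm (Fin p))⁻¹ i))
    (fun i => θ' ((y : Perm (Fin p))⁻¹ i))

/-- The `p` shifts of a non-constant family are distinct, so exactly the `p` diagonal pairs
contribute. -/
theorem charInner_wrInd_outer_self [Fintype G] [Fintype (Wr p G)] (θ : Fin p → Irr G)
    (hθ : ∃ i j, θ i ≠ θ j) :
    charInner (wrInd (outer fun i => (θ i).1)) (wrInd (outer fun i => (θ i).1)) = 1 := by
  classical
  rw [charInner_wrInd_outer]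
  have e : ∀ x y : Cyc p, ((fun i => θ ((x : Perm (Fin p))⁻¹ i)) =
      fun i => θ ((y : Perm (Fin p))⁻¹ i)) ↔ x = y := fun x y => by
    refine ⟨fun h => ?_, fun h => by rw [h]⟩
    have := cyc_eq_one_of_comp_eq θ hθ (x⁻¹ * y) fun i => by
      have := congrFun h ((y : Perm (Fin p)) i)
      simpa using this
    exact inv_mul_eq_one.mp this
  simp only [e, Finset.sum_ite_eq, Finset.mem_univ, if_true, Finset.sum_const, Finset.card_univ,
    ← Nat.card_eq_fintype_card, card_cyc, nsmul_eq_mul, mul_one]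
  exact inv_mul_cancel₀ (Nat.cast_ne_zero.mpr hp.out.ne_zero)

/-- If no shift takes one family to the other, the inner product of the two characters is zero; were
they equal it would be the norm of the first, which is one. -/
theorem wrInd_outer_eq_iff [Finite G] (θ θ' : Fin p → Irr G) (hθ : ∃ i j, θ i ≠ θ j) :
    (wrInd (outer fun i => (θ i).1) : Wr p G → ℂ) = wrInd (outer fun i => (θ' i).1) ↔
      ∃ c : Cyc p, ∀ i, θ i = θ' ((c : Perm (Fin p)) i) := by
  classical
  have := Fintype.ofFinite G
  have := Fintype.ofFinite (Wr p G)
  constructor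
  · intro h
    have h1 := charInner_wrInd_outer_self θ hθ
    by_contra! hc
    rw [show charInner (wrInd (outer fun i => (θ i).1)) (wrInd (outer fun i => (θ i).1)) =
      charInner (wrInd (outer fun i => (θ i).1)) (wrInd (outer fun i => (θ' i).1)) from
      congrArg _ h, charInner_wrInd_outer] at h1
    rw [Finset.sum_eq_zero fun x _ => Finset.sum_eq_zero fun y _ => if_neg ?_, mul_zero] at h1
    · exact zero_ne_one h1
    · intro e
      obtain ⟨i, hi⟩ := hc (y⁻¹ * x)
      have := congrFun e ((x : Perm (Fin p)) i)
      exact hi (by simpa using this)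
  · rintro ⟨c, hc⟩
    rw [← wrInd_outer_comp (fun i => (θ' i).1) c]
    simp only [hc]

theorem wrInd_outer_mem_irr [Finite G] (θ : Fin p → Irr G) (hθ : ∃ i j, θ i ≠ θ j) :
    ∃ φ : Irr (Wr p G), φ.1 = wrInd (outer fun i => (θ i).1) := by
  have := Fintype.ofFinite G
  have := Fintype.ofFinite (Wr p G)
  have hc : (wrIndRep (outerRep fun i => (θ i).rep)).character =
      wrInd (outer fun i => (θ i).1) := by
    rw [wrIndRep_character, outerRep_rep_character]
  rw [← hc]
  refine exists_irr_of_isIrreducible _ (isIrreducible_of_charInner_eq_one _ ?_)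
  rw [hc, charInner_wrInd_outer_self θ hθ]

/-- Off the base group the sum of the `φ_ε` vanishes; on it both sides are `p` copies of the same
external power. This expresses the induced character of a constant family through irreducible ones.
-/
theorem sum_wrX (φ : Irr G) :
    ∑ ε : Fin p, (wrX φ ε : Wr p G → ℂ) = wrInd (outer fun _ => φ.1) := by
  classical
  ext w
  rw [Finset.sum_apply]
  by_cases h : w.right = 1
  · rw [← inl_left_eq w h, wrInd_inl]
    simp only [wrX_inl, outer_comp_perm]
    rw [Finset.sum_const, Finset.sum_const, Finset.card_univ, Finset.card_univ,
      ← Nat.card_eq_fintype_card, ← Nat.card_eq_fintype_card, card_cyc, Nat.card_fin]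
  · rw [wrInd_of_right_ne_one _ _ h]
    simp only [wrX, ← Finset.mul_sum]
    rw [sum_cycChar, if_neg h, mul_zero]

theorem deltaOne_apply_one : deltaOne G 1 = 1 := by
  classical
  exact Pi.single_eq_same _ _

theorem deltaOne_apply_of_ne {g : G} (h : g ≠ 1) : deltaOne G g = 0 := by
  classical
  exact Pi.single_eq_of_ne h _

theorem wrInd_deltaOne :
    wrInd (deltaOne (Fin p → G)) = (p : ℂ) • deltaOne (Wr p G) := by
  ext w
  rw [Pi.smul_apply]
  by_cases h : w.right = 1
  · obtain ⟨n, rfl⟩ : ∃ n, SemidirectProduct.inl n = w := ⟨_, inl_left_eq w h⟩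
    rw [wrInd_inl]
    have e : ∀ x : Cyc p, deltaOne (Fin p → G) (fun i => n ((x : Perm (Fin p)) i)) =
        deltaOne (Wr p G) (SemidirectProduct.inl n) := fun x => by
      by_cases hn : n = 1
      · subst hn
        rw [map_one, deltaOne_apply_one]
        exact deltaOne_apply_one
      · rw [deltaOne_apply_of_ne, deltaOne_apply_of_ne]
        · rwa [← map_one SemidirectProduct.inl, Ne, SemidirectProduct.inl_inj]
        · exact fun e => hn (funext fun i => by simpa using congrFun e ((x : Perm (Fin p))⁻¹ i))
    simp only [e, Finset.sum_const, Finset.card_univ, ← Nat.card_eq_fintype_card, card_cyc]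
    simp
  · rw [wrInd_of_right_ne_one _ _ h, deltaOne_apply_of_ne, smul_zero]
    rintro rfl
    exact h rfl

end Classification

/-! ### Data for the irreducible characters of a wreath product -/

/-- Either an element of `X` with a label in `{0, …, p - 1}`, or a non-constant family of `p`
elements of `X`. -/
abbrev WrData (p : ℕ) (X : Type) : Type :=
  (X × Fin p) ⊕ {θ : Fin p → X // ∃ i j, θ i ≠ θ j}

namespace WrData

variable {p : ℕ} {X Y : Type}

/-- Equality up to a cyclic shift of the non-constant families. -/
def Rel : WrData p X → WrData p X → Prop
  | .inl a, .inl b => a = b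
  | .inr θ, .inr θ' => ∃ c : Cyc p, ∀ i, θ.1 i = θ'.1 ((c : Perm (Fin p)) i)
  | _, _ => False

/-- The effect of a bijection on data. -/
def map (e : X ≃ Y) : WrData p X → WrData p Y
  | .inl a => .inl (e a.1, a.2)
  | .inr θ => .inr ⟨fun i => e (θ.1 i), by
    obtain ⟨i, j, h⟩ := θ.2
    exact ⟨i, j, fun h' => h (e.injective h')⟩⟩

theorem rel_map_iff (e : X ≃ Y) (d d' : WrData p X) : Rel (d.map e) (d'.map e) ↔ Rel d d' := by
  rcases d with ⟨a, ε⟩ | θ <;> rcases d' with ⟨b, ε'⟩ | θ' <;> simp [Rel, map]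

theorem map_map_symm (e : X ≃ Y) (d : WrData p Y) : (d.map e.symm).map e = d := by
  rcases d with ⟨a, ε⟩ | θ <;> simp [map]

theorem map_symm_map (e : X ≃ Y) (d : WrData p X) : (d.map e).map e.symm = d := by
  rcases d with ⟨a, ε⟩ | θ <;> simp [map]

variable {A B : Type}

/-- A bijection between sets parametrized by the data for `X` and for `Y`. -/
def liftEquiv (e : X ≃ Y) (a : WrData p X → A) (ha : Function.Surjective a)
    (har : ∀ d d', a d = a d' ↔ Rel d d') (b : WrData p Y → B) (hb : Function.Surjective b)
    (hbr : ∀ d d', b d = b d' ↔ Rel d d') : A ≃ B where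
  toFun x := b ((Function.surjInv ha x).map e)
  invFun y := a ((Function.surjInv hb y).map e.symm)
  left_inv x := by
    conv_rhs => rw [← Function.surjInv_eq ha x]
    rw [har, ← rel_map_iff e, map_map_symm, ← hbr, Function.surjInv_eq hb]
  right_inv y := by
    conv_rhs => rw [← Function.surjInv_eq hb y]
    rw [hbr, ← rel_map_iff e.symm, map_symm_map, ← har,
      Function.surjInv_eq ha]

theorem liftEquiv_apply (e : X ≃ Y) (a : WrData p X → A) (ha : Function.Surjective a)
    (har : ∀ d d', a d = a d' ↔ Rel d d') (b : WrData p Y → B) (hb : Function.Surjective b)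
    (hbr : ∀ d d', b d = b d' ↔ Rel d d') (d : WrData p X) :
    liftEquiv e a ha har b hb hbr (a d) = b (d.map e) := by
  change b _ = b _
  rw [hbr, rel_map_iff, ← har, Function.surjInv_eq ha]

end WrData

/-! ### The data classify the irreducible characters of `G ≀ C_p` -/

section

variable {p : ℕ} [hp : Fact p.Prime] {G : Type} [Group G]

theorem exists_cyc_ne_one : ∃ h : Cyc p, h ≠ 1 := by
  obtain ⟨h, hh⟩ := exists_cyc_apply_zero (1 : Fin p)
  refine ⟨h, fun e => ?_⟩
  have h1 : (0 : Fin p) = 1 := by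
    rw [← hh, e]
    rfl
  have := congrArg Fin.val h1
  rw [Fin.val_one', Nat.mod_eq_of_lt hp.out.one_lt] at this
  exact zero_ne_one this

/-- Induced characters vanish off the base group, but `X(φ; ε)` does not vanish at a nontrivial
element of `C_p`. -/
theorem wrX_ne_wrInd (φ : Irr G) (ε : Fin p) (χ : (Fin p → G) → ℂ) : wrX φ ε ≠ wrInd χ := by
  obtain ⟨h, hh⟩ := exists_cyc_ne_one (p := p)
  intro e
  refine wrX_inr_ne_zero φ ε h ?_
  rw [e, wrInd_of_right_ne_one _ _ hh]

end

section Wreath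

variable {p : ℕ} [hp : Fact p.Prime] {G : Type} [Group G] [Finite G]

/-- The irreducible character `X(φ; ε)` or `(θ_1 × ⋯ × θ_p)↑` of `G ≀ C_p`. -/
def wrIrr : WrData p (Irr G) → Irr (Wr p G)
  | .inl a => ⟨wrX a.1 a.2, by
    obtain ⟨φ, hφ⟩ := exists_irr_of_isIrreducible _ (wrRep_isIrreducible a.1 a.2)
    rw [← wrRep_character, ← hφ]
    exact φ.2⟩
  | .inr θ => ⟨wrInd (outer fun i => (θ.1 i).1), by
    obtain ⟨φ, hφ⟩ := wrInd_outer_mem_irr θ.1 θ.2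
    rw [← hφ]
    exact φ.2⟩

theorem wrIrr_eq_iff (d d' : WrData p (Irr G)) : wrIrr d = wrIrr d' ↔ d.Rel d' := by
  refine Subtype.ext_iff.trans ?_
  rcases d with ⟨a, ε⟩ | θ <;> rcases d' with ⟨b, ε'⟩ | θ'
  · refine ⟨fun h => ?_, fun h => by rw [show (a, ε) = (b, ε') from h]⟩
    obtain ⟨rfl, rfl⟩ := wrX_injective hp.out.one_lt h
    exact rfl
  · exact ⟨fun h => (wrX_ne_wrInd _ _ _ h).elim, False.elim⟩
  · exact ⟨fun h => (wrX_ne_wrInd _ _ _ h.symm).elim, False.elim⟩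
  · exact wrInd_outer_eq_iff θ.1 θ'.1 θ.2

/-- Induce the expansion of the indicator function on `G^p`. Each induced term lies in the span, by
`sum_wrX` if its family is constant, and the left side becomes `p` times the indicator function on
`G ≀ C_p`. -/
theorem deltaOne_mem_span_wrIrr (hG : IrrComplete G) :
    deltaOne (Wr p G) ∈
      Submodule.span ℂ (Set.range fun d : WrData p (Irr G) => (wrIrr d).1) := by
  have h := Submodule.mem_map_of_mem (f := wrInd)
    (deltaOne_mem_span_outer (G := fun _ : Fin p => G) fun _ => hG)
  rw [wrInd_deltaOne, Submodule.map_span] at h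
  have hle : Submodule.span ℂ (wrInd '' Set.range fun θ : Fin p → Irr G => outer fun i => (θ i).1)
      ≤ Submodule.span ℂ (Set.range fun d : WrData p (Irr G) => (wrIrr d).1) := by
    rw [Submodule.span_le]
    rintro _ ⟨_, ⟨θ, rfl⟩, rfl⟩
    by_cases hθ : ∃ i j, θ i ≠ θ j
    · exact Submodule.subset_span ⟨.inr ⟨θ, hθ⟩, rfl⟩
    · push Not at hθ
      have e : θ = fun _ => θ 0 := funext fun i => hθ i 0
      rw [e]
      simp only
      rw [← sum_wrX]
      exact Submodule.sum_mem _ fun ε _ => Submodule.subset_span ⟨.inl (θ 0, ε), rfl⟩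
  have := Submodule.smul_mem _ (p : ℂ)⁻¹ (hle h)
  rwa [smul_smul, inv_mul_cancel₀ (Nat.cast_ne_zero.mpr hp.out.ne_zero), one_smul] at this

end Wreath

/-! ### Irreducible characters of the Sylow subgroups -/

section Sylow

variable {p : ℕ} [hp : Fact p.Prime] {k : ℕ}

theorem induce_comp_mulEquiv {N G H : Type} [Group N] [Group G] [Group H] (ι : N →* G)
    (hι : Function.Injective ι) (e : G ≃* H) (χ : N → ℂ) (x : H) :
    induce (e.toMonoidHom.comp ι) χ x = induce ι χ (e.symm x) := by
  unfold induce
  congr 1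
  rw [← finsum_comp_equiv e.toEquiv]
  refine finsum_congr fun g => ?_
  have h : ∀ y : G, Function.extend (e.toMonoidHom.comp ι) χ 0 (e y) =
      Function.extend ι χ 0 y := fun y => by
    have he : Function.Injective (e.toMonoidHom.comp ι) := e.injective.comp hι
    by_cases hy : ∃ n, ι n = y
    · obtain ⟨n, rfl⟩ := hy
      exact (he.extend_apply χ 0 n).trans (hι.extend_apply χ 0 n).symm
    · rw [Function.extend_apply' _ _ _ hy, Function.extend_apply']
      · rfl
      · exact fun ⟨n, hn⟩ => hy ⟨n, e.injective hn⟩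
  rw [← h]
  simp

theorem sylInd_eq (θ : Fin p → Irr (Syl p k)) (x : Syl p (k + 1)) :
    sylInd θ x = wrInd (outer fun i => (θ i).1) ((wrIso p k).symm x) := by
  rw [sylInd, baseHom, induce_comp_mulEquiv _ SemidirectProduct.inl_injective, induce_inl]
  intro m n
  unfold outer
  refine Finset.prod_congr rfl fun i _ => ?_
  have := (θ i).apply_conj (n i) (m i)⁻¹
  rwa [inv_inv] at this

/-- The irreducible character `X(φ; ε)` or `(θ_1 × ⋯ × θ_p)↑` of `P_{p^(k+1)}`. -/
def sylIrr (d : WrData p (Irr (Syl p k))) : Irr (Syl p (k + 1)) :=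
  irrCongr (wrIso p k) (wrIrr d)

theorem sylIrr_inl (φ : Irr (Syl p k)) (ε : Fin p) :
    (sylIrr (.inl (φ, ε))).1 = sylX φ ε :=
  rfl

theorem sylIrr_inr (θ : {θ : Fin p → Irr (Syl p k) // ∃ i j, θ i ≠ θ j}) :
    (sylIrr (.inr θ)).1 = sylInd θ.1 :=
  funext fun x => (sylInd_eq θ.1 x).symm

theorem sylIrr_eq_iff (d d' : WrData p (Irr (Syl p k))) : sylIrr d = sylIrr d' ↔ d.Rel d' :=
  (irrCongr _).injective.eq_iff.trans (wrIrr_eq_iff d d')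

instance syl_zero_subsingleton : Subsingleton (Syl p 0) :=
  inferInstanceAs (Subsingleton (⊥ : Subgroup _))

theorem irrComplete_syl (k : ℕ) : IrrComplete (Syl p k) := by
  induction k with
  | zero =>
    exact irrComplete_of_mem_span _ span_irrOne_of_subsingleton
  | succ k ih =>
    exact (irrComplete_of_mem_span _ (deltaOne_mem_span_wrIrr ih)).congr (wrIso p k)

theorem sylIrr_surjective : Function.Surjective (sylIrr : WrData p (Irr (Syl p k)) → _) :=
  (irrCongr _).surjective.comp
    (surjective_of_deltaOne_mem_span _ (deltaOne_mem_span_wrIrr (irrComplete_syl k)))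

instance irr_syl_zero_subsingleton : Subsingleton (Irr (Syl p 0)) :=
  ⟨irr_subsingleton⟩

/-- All tensor powers of the trivial one-dimensional module are trivial. This makes the base clause
`Φ_p` the case `k = 0` of the general step; `node_zero` plays the same role for trees. -/
theorem sylX_zero (φ : Irr (Syl p 0)) (ε : Fin p) : sylX φ ε = linChar ε := by
  obtain rfl := irr_subsingleton (irrOne _) φ
  have hd : ((irrOne (Syl p 0)).dim : ℂ) = 1 := (Irr.apply_one _).symm
  have hd' : (irrOne (Syl p 0)).dim = 1 := by exact_mod_cast hd
  ext x
  rw [sylX, wrX, linChar]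
  refine (mul_eq_right₀ (cycChar_ne_zero _ _)).mpr ?_
  refine (trace_map_comp_reindex (Pi.basisFun ℂ (Fin (irrOne (Syl p 0)).dim)) _ _).trans ?_
  have hs : Subsingleton (Fin (irrOne (Syl p 0)).dim) := by
    rw [hd']
    infer_instance
  have h1 : ∀ w : Syl p 0, (irrOne (Syl p 0)).rep w = 1 := fun w => by
    rw [Subsingleton.elim w 1, map_one]
  have hc : Fintype.card (Fin p → Fin (irrOne (Syl p 0)).dim) = 1 := by
    rw [Fintype.card_fun, Fintype.card_fin, hd', one_pow]
  refine (Finset.sum_congr rfl (g := fun _ => (1 : ℂ)) fun a _ =>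
    Finset.prod_eq_one fun i _ => ?_).trans ?_
  · rw [h1, Module.End.one_apply, Module.Basis.repr_self,
      Subsingleton.elim (a _) (a i), Finsupp.single_eq_same]
  · rw [Finset.sum_const, Finset.card_univ, hc, one_smul]

end Sylow

/-! ### Admissible tree functions -/

section Tree

variable {p k : ℕ}

/-- The labelling subfunction rooted at the `i`-th vertex below the root. -/
def child (t : Lab p (k + 1)) (i : Fin p) : Lab p k :=
  fun q => t ⟨i :: q.1, Nat.succ_lt_succ q.2⟩

theorem labNode_child (t : Lab p (k + 1)) :
    labNode (child t) (t ⟨[], Nat.succ_pos k⟩) = t := by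
  ext ⟨_ | ⟨i, q⟩, h⟩ <;> rfl

instance tree_zero_subsingleton : Subsingleton (Tree p 0) := by
  have : IsEmpty (Skel p 0) := ⟨fun s => Nat.not_lt_zero _ s.2⟩
  exact inferInstanceAs (Subsingleton (Quotient _))

/-- A vertex other than the root lies in the subtree of a child, so the conditions at all vertices
split into those at the root and admissibility of the children. For `k = 0` all children coincide,
so "not all equal" is impossible and the root label cannot be `p`. -/
theorem adm_succ_iff (t : Lab p (k + 1)) : Adm (k + 1) t ↔
    (∀ i, Adm k (child t i)) ∧
    (t ⟨[], Nat.succ_pos k⟩ ≠ Fin.last p → ∀ i j, cls (child t i) = cls (child t j)) ∧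
    (t ⟨[], Nat.succ_pos k⟩ = Fin.last p → ∃ i j, cls (child t i) ≠ cls (child t j)) := by
  rcases k with _ | k
  · rw [Adm]
    refine ⟨fun h => ⟨fun i => by rw [Adm]; trivial, fun _ i j => Subsingleton.elim _ _,
      fun h' => (h h').elim⟩, fun h h' => ?_⟩
    obtain ⟨i, j, hij⟩ := h.2.2 h'
    exact hij (Subsingleton.elim _ _)
  · constructor
    · intro h
      rw [Adm] at h
      obtain ⟨-, h⟩ := h
      obtain ⟨h1, h2⟩ := h [] k (by simp; omega)
      refine ⟨fun i => ?_, fun h' => (h1 h').2, fun h' => (h2 h').2⟩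
      by_cases h' : t ⟨[], Nat.succ_pos _⟩ = Fin.last p
      · exact (h2 h').1 i
      · exact (h1 h').1 i
    · rintro ⟨h0, h1, h2⟩
      rw [Adm]
      refine ⟨?_, ?_⟩
      -- A bottom vertex is never the root here, as the height is at least two; it is a bottom
      -- vertex of child `i`.
      · rintro ⟨_ | ⟨i, s⟩, hs⟩ hl
        · simp at hl
        · have := h0 i
          simp only [List.length_cons, Nat.add_right_cancel_iff] at hl
          rcases k with _ | k
          · rw [Adm] at this
            obtain rfl := List.length_eq_zero_iff.mp hl
            exact this
          · rw [Adm] at this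
            exact this.1 ⟨s, by omega⟩ hl
      · rintro (_ | ⟨i, s⟩) m h
        · obtain rfl : m = k := by simp at h; omega
          exact ⟨fun h' => ⟨h0, h1 h'⟩, fun h' => ⟨h0, h2 h'⟩⟩
        · have := h0 i
          rcases k with _ | k
          · simp only [List.length_cons] at h
            omega
          · rw [Adm] at this
            exact this.2 s m (by simp at h ⊢; omega)

/-- The permutation at the root is the shift `c`, and those at words beginning with `i` form an
equivalence of the `i`-th subtree with its image; conversely such choices glue. -/
theorem labRel_labNode_iff (f f' : Fin p → Lab p k) (ε ε' : Fin (p + 1)) :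
    LabRel (labNode f ε) (labNode f' ε') ↔
      ε = ε' ∧ ∃ c : Cyc p, ∀ i, LabRel (f i) (f' ((c : Perm (Fin p)) i)) := by
  constructor
  · rintro ⟨γ, h⟩
    exact ⟨h ⟨[], Nat.succ_pos k⟩, γ [], fun i => ⟨fun q => γ (i :: q), fun q =>
      h ⟨i :: q.1, Nat.succ_lt_succ q.2⟩⟩⟩
  · rintro ⟨rfl, c, h⟩
    choose γ hγ using h
    refine ⟨fun q => match q with
      | [] => c
      | i :: q => γ i q, ?_⟩
    rintro ⟨_ | ⟨i, q⟩, hs⟩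
    · rfl
    · exact hγ i ⟨q, Nat.lt_of_succ_lt_succ hs⟩

theorem cls_eq_iff (t t' : Lab p k) : cls t = cls t' ↔ LabRel t t' :=
  ⟨fun h => Quotient.exact (s := labSetoid p k) h, fun h => Quotient.sound (s := labSetoid p k) h⟩

theorem node_eq_iff (T T' : Fin p → Tree p k) (ε ε' : Fin (p + 1)) :
    node T ε = node T' ε' ↔ ε = ε' ∧ ∃ c : Cyc p, ∀ i, T i = T' ((c : Perm (Fin p)) i) := by
  rw [node, node, cls_eq_iff, labRel_labNode_iff]
  simp only [← cls_eq_iff]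
  have h : ∀ T : Tree p k, cls T.out = T := Quotient.out_eq
  simp only [h]

/-- The admissible tree function `(T | ⋯ | T; ε)` with `ε < p`, or `(T_1 | ⋯ | T_p; p)` with
`T_1, …, T_p` not all equal. -/
def admNode (d : WrData p (AdmTree p k)) : AdmTree p (k + 1) :=
  match d with
  | .inl a => ⟨node (fun _ => a.1.1) a.2.castSucc, by
    obtain ⟨⟨T, t, rfl, ht⟩, ε⟩ := a
    refine ⟨labNode (fun _ => t) ε.castSucc, (node_cls _ _).symm, ?_⟩
    rw [adm_succ_iff]
    exact ⟨fun _ => ht, fun _ _ _ => rfl, fun h => ((Fin.castSucc_lt_last ε).ne h).elim⟩⟩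
  | .inr θ => ⟨node (fun i => (θ.1 i).1) (Fin.last p), by
    obtain ⟨θ, i, j, hij⟩ := θ
    choose t ht ht' using fun i => (θ i).2
    have e : (fun i => (θ i).1) = fun i => cls (t i) := funext fun i => (ht i).symm
    simp only [e]
    refine ⟨labNode t (Fin.last p), (node_cls _ _).symm, ?_⟩
    rw [adm_succ_iff]
    refine ⟨ht', fun h => (h rfl).elim, fun _ => ⟨i, j, fun h => hij (Subtype.ext ?_)⟩⟩
    exact (ht i).symm.trans (h.trans (ht j))⟩

/-- The relation is the one in `sylIrr_eq_iff`; this agreement is what `WrData.liftEquiv` needs. A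
constant family is invariant under every shift, so in the labelled case none remains. -/
theorem admNode_eq_iff [NeZero p] (d d' : WrData p (AdmTree p k)) :
    admNode d = admNode d' ↔ d.Rel d' := by
  rw [Subtype.ext_iff]
  rcases d with ⟨⟨T, hT⟩, ε⟩ | θ <;> rcases d' with ⟨⟨T', hT'⟩, ε'⟩ | θ' <;>
    refine (node_eq_iff _ _ _ _).trans ?_
  · simp only [WrData.Rel, Prod.mk.injEq, Subtype.mk.injEq, Fin.castSucc_inj]
    exact ⟨fun h => ⟨h.2.choose_spec 0, h.1⟩, fun h => ⟨h.2, 1, fun _ => h.1⟩⟩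
  · exact ⟨fun h => (Fin.castSucc_lt_last ε).ne h.1, False.elim⟩
  · exact ⟨fun h => (Fin.castSucc_lt_last ε').ne h.1.symm, False.elim⟩
  · simp only [WrData.Rel, true_and, Subtype.ext_iff]

theorem admNode_surjective [NeZero p] :
    Function.Surjective (admNode : WrData p (AdmTree p k) → AdmTree p (k + 1)) := by
  rintro ⟨T, t, rfl, ht⟩
  obtain ⟨h0, h1, h2⟩ := (adm_succ_iff t).mp ht
  have hn : node (fun i => cls (child t i)) (t ⟨[], Nat.succ_pos k⟩) = cls t := by
    rw [node_cls, labNode_child]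
  by_cases h : t ⟨[], Nat.succ_pos k⟩ = Fin.last p
  · refine ⟨.inr ⟨fun i => ⟨cls (child t i), _, rfl, h0 i⟩, ?_⟩, Subtype.ext ?_⟩
    · obtain ⟨i, j, hij⟩ := h2 h
      exact ⟨i, j, fun e => hij (congrArg Subtype.val e)⟩
    · rw [h] at hn
      exact hn
  · refine ⟨.inl (⟨cls (child t 0), _, rfl, h0 0⟩, (t ⟨[], Nat.succ_pos k⟩).castPred h),
      Subtype.ext ?_⟩
    rw [show (fun i => cls (child t i)) = fun _ => cls (child t 0) from
      funext fun i => h1 h i 0, ← Fin.castSucc_castPred _ h] at hn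
    exact hn

instance admTree_zero_subsingleton : Subsingleton (AdmTree p 0) :=
  ⟨fun _ _ => Subtype.ext (Subsingleton.elim _ _)⟩

instance admTree_zero_nonempty : Nonempty (AdmTree p 0) :=
  ⟨⟨cls fun s => (Nat.not_lt_zero _ s.2).elim, _, rfl, by rw [Adm]; trivial⟩⟩

theorem node_zero (T : Fin p → Tree p 0) (ε : Fin (p + 1)) : node T ε = leaf ε := by
  refine congrArg cls (funext ?_)
  rintro ⟨_ | ⟨i, q⟩, h⟩
  · rfl
  · simp at h

end Tree

/-! ### The bijections -/

section Bijection

variable {p : ℕ} [hp : Fact p.Prime]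

instance irr_syl_zero_nonempty : Nonempty (Irr (Syl p 0)) := ⟨irrOne _⟩

/-- The bijection `Φ_{p^k}` between irreducible characters and admissible tree functions. -/
def irrTreeEquiv (p : ℕ) [Fact p.Prime] : ∀ k, Irr (Syl p k) ≃ AdmTree p k
  | 0 => Equiv.ofBijective (fun _ => Classical.arbitrary _)
    ⟨fun _ _ _ => Subsingleton.elim _ _, fun _ => ⟨Classical.arbitrary _, Subsingleton.elim _ _⟩⟩
  | k + 1 => WrData.liftEquiv (irrTreeEquiv p k) sylIrr sylIrr_surjective sylIrr_eq_iff
      admNode admNode_surjective admNode_eq_iff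

theorem irrTreeEquiv_sylIrr (k : ℕ) (d : WrData p (Irr (Syl p k))) :
    irrTreeEquiv p (k + 1) (sylIrr d) = admNode (d.map (irrTreeEquiv p k)) :=
  WrData.liftEquiv_apply _ _ _ _ _ _ _ _

theorem irrTreeEquiv_symm_admNode (k : ℕ) (d : WrData p (AdmTree p k)) :
    (irrTreeEquiv p (k + 1)).symm (admNode d) = sylIrr (d.map (irrTreeEquiv p k).symm) := by
  rw [Equiv.symm_apply_eq, irrTreeEquiv_sylIrr, WrData.map_map_symm]

theorem isPhi_irrTreeEquiv : IsPhi p fun k => irrTreeEquiv p k where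
  base θ ε h := by
    obtain rfl : θ = sylIrr (.inl (irrOne _, ε)) := Subtype.ext (h.trans (sylX_zero _ ε).symm)
    simp only [irrTreeEquiv_sylIrr]
    exact node_zero _ _
  extend k _ θ φ ε h := by
    obtain rfl : θ = sylIrr (.inl (φ, ε)) := Subtype.ext h
    simp only [irrTreeEquiv_sylIrr]
    rfl
  induced k _ θ θs hθ h := by
    obtain rfl : θ = sylIrr (.inr ⟨θs, hθ⟩) := Subtype.ext (h.trans (sylIrr_inr ⟨θs, hθ⟩).symm)
    simp only [irrTreeEquiv_sylIrr]
    rfl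

/-- Every character is some `sylIrr d`, so one of the clauses fixes its image. At the bottom the
codomain is a point, and over `P_1` there are no non-constant families. -/
theorem IsPhi.eq_irrTreeEquiv {Φ : ∀ k, Irr (Syl p k) → AdmTree p k} (h : IsPhi p Φ) :
    Φ = fun k => ⇑(irrTreeEquiv p k) := by
  funext k
  induction k with
  | zero => exact funext fun _ => Subsingleton.elim _ _
  | succ k ih =>
    funext θ
    obtain ⟨d, rfl⟩ := sylIrr_surjective θ
    rw [irrTreeEquiv_sylIrr]
    apply Subtype.ext
    rcases k with _ | k
    · rcases d with ⟨φ, ε⟩ | ⟨θs, i, j, hij⟩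
      · exact (h.base _ ε ((sylIrr_inl φ ε).trans (sylX_zero φ ε))).trans (node_zero _ _).symm
      · exact (hij (Subsingleton.elim _ _)).elim
    · rcases d with ⟨φ, ε⟩ | ⟨θs, hθ⟩
      · refine (h.extend (k + 1) (Nat.succ_pos k) _ φ ε (sylIrr_inl φ ε)).trans ?_
        rw [ih]
        rfl
      · refine (h.induced (k + 1) (Nat.succ_pos k) _ θs hθ (sylIrr_inr ⟨θs, hθ⟩)).trans ?_
        rw [ih]
        rfl

theorem isPsi_irrTreeEquiv_symm : IsPsi p fun k => (irrTreeEquiv p k).symm where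
  base T ε h := by
    obtain rfl : T = admNode (.inl (Classical.arbitrary _, ε)) :=
      Subtype.ext (h.trans (node_zero _ _).symm)
    simp only [irrTreeEquiv_symm_admNode]
    exact (sylIrr_inl _ ε).trans (sylX_zero _ ε)
  extend k _ T Ts ε h := by
    obtain ⟨d, rfl⟩ := admNode_surjective T
    rcases d with ⟨T', ε'⟩ | θ
    · obtain ⟨h1, c, h2⟩ := (node_eq_iff _ _ _ _).mp h
      obtain rfl := Fin.castSucc_injective _ h1
      -- `Ts` is a shift of the constant family `T'`; the index sent to `0` by `c` gives `T' = Ts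
      -- 0`.
      obtain rfl : T' = Ts 0 := Subtype.ext (by simpa using h2 ((c : Perm (Fin p))⁻¹ 0))
      simp only [irrTreeEquiv_symm_admNode]
      exact sylIrr_inl _ _
    · exact ((Fin.castSucc_lt_last ε).ne ((node_eq_iff _ _ _ _).mp h).1.symm).elim
  induced k _ T Ts h := by
    obtain ⟨d, rfl⟩ := admNode_surjective T
    rcases d with ⟨T', ε'⟩ | ⟨θ, i, j, hij⟩
    · exact ((Fin.castSucc_lt_last ε').ne ((node_eq_iff _ _ _ _).mp h).1).elim
    · obtain ⟨-, c, hc⟩ := (node_eq_iff _ _ _ _).mp h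
      have hTs : ∃ i j, Ts i ≠ Ts j := by
        refine ⟨(c : Perm (Fin p)) i, (c : Perm (Fin p)) j, fun e => hij (Subtype.ext ?_)⟩
        exact (hc i).trans ((congrArg Subtype.val e).trans (hc j).symm)
      -- The given presentation `Ts` may be a shift of the chosen `θ`; it is also non-constant, so
      -- it can replace `θ`.
      have e : admNode (.inr ⟨θ, i, j, hij⟩) = admNode (.inr ⟨Ts, hTs⟩) := Subtype.ext h
      simp only [e, irrTreeEquiv_symm_admNode]
      exact sylIrr_inr _

theorem IsPsi.eq_irrTreeEquiv_symm {Ψ : ∀ k, AdmTree p k → Irr (Syl p k)} (h : IsPsi p Ψ) :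
    Ψ = fun k => ⇑(irrTreeEquiv p k).symm := by
  funext k
  induction k with
  | zero => exact funext fun _ => Subsingleton.elim _ _
  | succ k ih =>
    funext T
    obtain ⟨d, rfl⟩ := admNode_surjective T
    rw [irrTreeEquiv_symm_admNode]
    apply Subtype.ext
    rcases k with _ | k
    · rcases d with ⟨T, ε⟩ | ⟨θ, i, j, hij⟩
      · refine (h.base _ ε (node_zero _ _)).trans ?_
        exact ((sylIrr_inl ((irrTreeEquiv p 0).symm T) ε).trans (sylX_zero _ ε)).symm
      · exact (hij (Subsingleton.elim _ _)).elim
    · rcases d with ⟨T, ε⟩ | ⟨θ, hθ⟩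
      · refine (h.extend (k + 1) (Nat.succ_pos k) _ (fun _ => T) ε rfl).trans ?_
        rw [ih]
        exact (sylIrr_inl (p := p) _ _).symm
      · refine (h.induced (k + 1) (Nat.succ_pos k) _ θ rfl).trans ?_
        rw [ih]
        exact funext (sylInd_eq fun i => (irrTreeEquiv p (k + 1)).symm (θ i))

/-- The irreducible characters of `P_n` are the external products. -/
def irrSylNEquiv (p n : ℕ) [Fact p.Prime] :
    (∀ j : Fin (numFactors p n), Irr (Syl p (expo p n j))) ≃ Irr (SylN p n) :=
  (Equiv.ofBijective irrOuter (irrOuter_bijective fun _ => irrComplete_syl _)).trans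
    (irrCongr (prodIso p n))

end Bijection

end SylowTree

end

open SylowTree
theorem lemma3 (p : ℕ) [Fact p.Prime] :
    ∃ (Φ : ∀ k, Irr (Syl p k) → AdmTree p k) (Ψ : ∀ k, AdmTree p k → Irr (Syl p k)),
      -- the recursion defines exactly one family of maps `Φ`
      (∀ Φ', IsPhi p Φ' ↔ Φ' = Φ) ∧
      -- each of them is a bijection, with inverse `Ψ`
      (∀ k, Function.Bijective (Φ k)) ∧
      (∀ k, Function.LeftInverse (Ψ k) (Φ k) ∧ Function.RightInverse (Ψ k) (Φ k)) ∧
      -- the inverse is the one and only family given by its recursion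
      (∀ Ψ', IsPsi p Ψ' ↔ Ψ' = Ψ) ∧
      -- the case of general `n`, componentwise
      ∀ n : ℕ,
        (∀ θ : Irr (SylN p n),
          ∃! θs : ∀ j : Fin (numFactors p n), Irr (Syl p (expo p n j)), θ.1 = sylOuter θs) ∧
        ∃ (Φn : Irr (SylN p n) → ∀ j : Fin (numFactors p n), AdmTree p (expo p n j))
          (Ψn : (∀ j : Fin (numFactors p n), AdmTree p (expo p n j)) → Irr (SylN p n)),
          (∀ (θ : Irr (SylN p n)) (θs : ∀ j : Fin (numFactors p n), Irr (Syl p (expo p n j))),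
            θ.1 = sylOuter θs → Φn θ = fun j => Φ _ (θs j)) ∧
          Function.Bijective Φn ∧
          Function.LeftInverse Ψn Φn ∧ Function.RightInverse Ψn Φn ∧
          ∀ T, (Ψn T).1 = sylOuter (fun j => Ψ _ (T j)) := by
  refine ⟨fun k => irrTreeEquiv p k, fun k => (irrTreeEquiv p k).symm,
    fun Φ' => ⟨IsPhi.eq_irrTreeEquiv, fun h => h ▸ isPhi_irrTreeEquiv⟩,
    fun k => (irrTreeEquiv p k).bijective,
    fun k => ⟨(irrTreeEquiv p k).left_inv, (irrTreeEquiv p k).right_inv⟩,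
    fun Ψ' => ⟨IsPsi.eq_irrTreeEquiv_symm, fun h => h ▸ isPsi_irrTreeEquiv_symm⟩,
    fun n => ⟨fun θ => ?_, ?_⟩⟩
  · refine ⟨(irrSylNEquiv p n).symm θ, ?_, fun θs h => ?_⟩
    · exact congrArg Subtype.val ((irrSylNEquiv p n).apply_symm_apply θ).symm
    · exact ((irrSylNEquiv p n).symm_apply_eq.mpr (Subtype.ext h)).symm
  · let e := (irrSylNEquiv p n).symm.trans (Equiv.piCongrRight fun j => irrTreeEquiv p (expo p n j))
    -- The formula for the inverse is definitional, since `irrSylNEquiv` sends a family to its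
    -- external product carried along `prodIso`.
    refine ⟨e, e.symm, fun θ θs h => ?_, e.bijective, e.left_inv, e.right_inv, fun T => rfl⟩
    obtain rfl : θ = irrSylNEquiv p n θs := Subtype.ext h
    funext j
    simp [e]
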